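/- Let $d\ge 2$ and let $\Omega\subset\mathbb R^d$ be a bounded domain (nonempty, open, connected; no regularity of $\partial\Omega$ is needed). Let $a_{i,j}\in L^\infty(\Omega;\mathbb R)$, $1\le i,j\le d$, satisfy $a_{i,j}=a_{j,i}$ a.e. and, for some $c>0$ and a.e. $x\in\Omega$, $\sum_{i,j}a_{i,j}(x)\xi_i\xi_j\ge c|\xi|^2$ for all $\xi\in\mathbb R^d$. Let $q\in L^\kappa(\Omega;\mathbb R)$ with $\kappa\in(d,+\infty]$ and $q\ge 0$ a.e., and let $\alpha,\rho\in L^\infty(\Omega;\mathbb R)$ satisfy, for a.e. $x\in\Omega$, $0<\alpha_0\le\alpha(x)\le\alpha_M<1$ and $0<\rho_0\le\rho(x)\le\rho_M<+\infty$ with constants $\alpha_0,\alpha_M,\rho_0,\rho_M$. Let $H^1_0(\Omega)$ be the closure of $C_c^\infty(\Omega;\mathbb C)$ in $H^1(\Omega;\mathbb C)$, and let $A_0$ be the operator in $L^2(\Omega)=L^2(\Omega;\mathbb C)$ generated by the form $a_0(u,v)=\sum_{i,j}\int_\Omega a_{i,j}\,\partial_{x_i}u\,\overline{\partial_{x_j}v}\,dx$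 on $H_0^1(\Omega)$; that is, $u\in D(A_0)$ and $A_0u=f$ if and only if $u\in H^1_0(\Omega)$, $f\in L^2(\Omega)$ and $a_0(u,v)=\langle f,v\rangle_{L^2(\Omega)}$ for all $v\in H^1_0(\Omega)$. Put $A_q:=A_0+q$, with domain $\{u\in D(A_0):\ qu\in L^2(\Omega)\}$. Powers $p^{\alpha(x)}$ are taken with the principal branch on $\mathbb C\setminus\mathbb R_-$, where $\mathbb R_-=(-\infty,0]$. Then $D(A_q)=D(A_0)$, and: 1. For every $p\in\mathbb C\setminus\mathbb R_-$, the operator $A_q+\rho(x)p^{\alpha(x)}$ is boundedly invertible in $L^2(\Omega)$, and $(A_q+\rho(x)p^{\alpha(x)})^{-1}$ maps $L^2(\Omega)$ into $D(A_0)$. 2. For all $r\in(0,+\infty)$ and $\beta\in(-\pi,\pi)$, $$\big\|(A_q+\rho(x)r^{\alpha(x)}e^{i\beta\alpha(x)})^{-1}\big\|_{\mathcal B(L^2(\Omega))}\le C(r,\beta)\max_{j=0,M}r^{-\alpha_j},$$ where $$C(r,\beta):=\begin{cases}2\rho_0^{-1},&|\beta|\le\theta_*(r),\\ \rho_0^{-1}c_*(\beta),&\text{otherwise,}\end{cases}$$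 $$\theta_*(r):=\alpha_M^{-1}\min_{\sigma=\pm1}\arctan\Big(\frac{\rho_0}{3\rho_M}r^{\sigma(\alpha_M-\alpha_0)}\Big),\qquad c_*(\beta):=\max_{j=0,M}|\sin(\alpha_j\beta)|^{-1}.$$ 3. The map $p\mapsto(A_q+\rho(x)p^{\alpha(x)})^{-1}$ is holomorphic and bounded on $\mathbb C\setminus\mathbb R_-$ with values in $\mathcal B(L^2(\Omega))$, i.e. its operator norm is bounded uniformly in $p\in\mathbb C\setminus\mathbb R_-$. -/

import Mathlib

open MeasureTheory
open scoped ENNReal ContDiff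

namespace VariableOrder

/-- `d`-dimensional Euclidean space. -/
abbrev Space (d : ℕ) : Type := EuclideanSpace ℝ (Fin d)

/-- The complex Hilbert space `L²(Ω)`. -/
abbrev L2 {d : ℕ} (Ω : Set (Space d)) : Type :=
  Lp ℂ 2 ((volume : Measure (Space d)).restrict Ω)

/-- The classical partial derivative `∂φ/∂xᵢ`. -/
noncomputable def partialDeriv {d : ℕ} (i : Fin d) (φ : Space d → ℂ) (x : Space d) : ℂ :=
  fderiv ℝ φ x (EuclideanSpace.single i (1 : ℝ))

/-- `φ ∈ C_c^∞(Ω)`. -/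
structure IsTestFunction {d : ℕ} (Ω : Set (Space d)) (φ : Space d → ℂ) : Prop where
  smooth : ContDiff ℝ ∞ φ
  compact : HasCompactSupport φ
  support_subset : tsupport φ ⊆ Ω

namespace IsTestFunction

variable {d : ℕ} {Ω : Set (Space d)} {φ ψ : Space d → ℂ}

theorem zero : IsTestFunction Ω (0 : Space d → ℂ) :=
  ⟨contDiff_const, HasCompactSupport.zero, by simp⟩

theorem add (hφ : IsTestFunction Ω φ) (hψ : IsTestFunction Ω ψ) : IsTestFunction Ω (φ + ψ) :=
  ⟨hφ.smooth.add hψ.smooth, hφ.compact.add hψ.compact,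
    (tsupport_add φ ψ).trans (Set.union_subset hφ.support_subset hψ.support_subset)⟩

theorem smul (c : ℂ) (hφ : IsTestFunction Ω φ) : IsTestFunction Ω (c • φ) :=
  ⟨contDiff_const.smul hφ.smooth, hφ.compact.smul_left (f := fun _ => c),
    (closure_mono (Function.support_const_smul_subset c φ)).trans hφ.support_subset⟩

theorem differentiable (hφ : IsTestFunction Ω φ) : Differentiable ℝ φ :=
  hφ.smooth.differentiable (by simp)

theorem continuous_partialDeriv (hφ : IsTestFunction Ω φ) (i : Fin d) :
    Continuous (partialDeriv i φ) :=
  (hφ.smooth.continuous_fderiv (by simp)).clm_apply continuous_const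

theorem compact_partialDeriv (hφ : IsTestFunction Ω φ) (i : Fin d) :
    HasCompactSupport (partialDeriv i φ) :=
  hφ.compact.fderiv_apply ℝ _

theorem support_partialDeriv (hφ : IsTestFunction Ω φ) (i : Fin d) :
    Function.support (partialDeriv i φ) ⊆ Ω := fun x hx =>
  hφ.support_subset (support_fderiv_subset ℝ (fun h => hx (by simp [partialDeriv, h])))

theorem memLp (hφ : IsTestFunction Ω φ) (p : ℝ≥0∞) (μ : Measure (Space d))
    [IsFiniteMeasureOnCompacts μ] : MemLp φ p μ :=
  hφ.smooth.continuous.memLp_of_hasCompactSupport hφ.compact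

theorem memLp_partialDeriv (hφ : IsTestFunction Ω φ) (i : Fin d) (p : ℝ≥0∞)
    (μ : Measure (Space d)) [IsFiniteMeasureOnCompacts μ] : MemLp (partialDeriv i φ) p μ :=
  (hφ.continuous_partialDeriv i).memLp_of_hasCompactSupport (hφ.compact_partialDeriv i)

theorem partialDeriv_add (hφ : IsTestFunction Ω φ) (hψ : IsTestFunction Ω ψ) (i : Fin d) :
    partialDeriv i (φ + ψ) = partialDeriv i φ + partialDeriv i ψ := by
  funext x
  simp [partialDeriv, fderiv_add (hφ.differentiable x) (hψ.differentiable x)]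

theorem partialDeriv_smul (c : ℂ) (hφ : IsTestFunction Ω φ) (i : Fin d) :
    partialDeriv i (c • φ) = c • partialDeriv i φ := by
  funext x
  simp [partialDeriv, fderiv_const_smul (hφ.differentiable x) c]

end IsTestFunction

theorem L2.integrable_mul {d : ℕ} {Ω : Set (Space d)} (u : L2 Ω) {g : Space d → ℂ}
    (hg : MemLp g 2 (volume.restrict Ω)) :
    Integrable (fun x => u x * g x) (volume.restrict Ω) :=
  (Lp.memLp u).integrable_mul hg

/-- The Sobolev space `H¹(Ω)`, realised as the space of all pairs `(u, g)` where `u ∈ L²(Ω)` and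
`g = (g₁, …, g_d)`, `gᵢ ∈ L²(Ω)`, is the weak gradient of `u`. -/
noncomputable def sobolevH1 {d : ℕ} (Ω : Set (Space d)) :
    Submodule ℂ (L2 Ω × (Fin d → L2 Ω)) where
  carrier := {w | ∀ φ : Space d → ℂ, IsTestFunction Ω φ → ∀ i : Fin d,
    ∫ x in Ω, w.1 x * partialDeriv i φ x = -∫ x in Ω, w.2 i x * φ x}
  zero_mem' := by
    intro φ _ i
    have h0 : ((0 : L2 Ω) : Space d → ℂ) =ᵐ[volume.restrict Ω] 0 := Lp.coeFn_zero _ _ _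
    have h1 : ∫ x in Ω, (0 : L2 Ω) x * partialDeriv i φ x = 0 := by
      rw [integral_congr_ae (g := fun _ => 0)]
      · simp
      · filter_upwards [h0] with x hx
        rw [hx, Pi.zero_apply, zero_mul]
    have h2 : ∫ x in Ω, (0 : L2 Ω) x * φ x = 0 := by
      rw [integral_congr_ae (g := fun _ => 0)]
      · simp
      · filter_upwards [h0] with x hx
        rw [hx, Pi.zero_apply, zero_mul]
    exact h1.trans (neg_eq_zero.mpr h2).symm
  add_mem' := by
    intro v w hv hw φ hφ i
    have key : ∀ (a b : L2 Ω) (ψ : Space d → ℂ), MemLp ψ 2 (volume.restrict Ω) →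
        ∫ x in Ω, (a + b) x * ψ x = (∫ x in Ω, a x * ψ x) + ∫ x in Ω, b x * ψ x := by
      intro a b ψ hψ
      rw [← integral_add (L2.integrable_mul a hψ) (L2.integrable_mul b hψ)]
      refine integral_congr_ae ?_
      filter_upwards [Lp.coeFn_add a b] with x hx
      rw [hx, Pi.add_apply, add_mul]
    have e1 := key v.1 w.1 _ (hφ.memLp_partialDeriv i 2 _)
    have e2 := key (v.2 i) (w.2 i) _ (hφ.memLp 2 _)
    have hv' := hv φ hφ i
    have hw' := hw φ hφ i
    change ∫ x in Ω, (v.1 + w.1) x * partialDeriv i φ x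
      = -∫ x in Ω, (v.2 i + w.2 i) x * φ x
    rw [e1, e2, hv', hw']
    ring
  smul_mem' := by
    intro c w hw φ hφ i
    have key : ∀ (a : L2 Ω) (ψ : Space d → ℂ),
        ∫ x in Ω, (c • a) x * ψ x = c * ∫ x in Ω, a x * ψ x := by
      intro a ψ
      rw [← integral_const_mul]
      refine integral_congr_ae ?_
      filter_upwards [Lp.coeFn_smul c a] with x hx
      rw [hx, Pi.smul_apply, smul_eq_mul, mul_assoc]
    have hw' := hw φ hφ i
    change ∫ x in Ω, (c • w.1) x * partialDeriv i φ x = -∫ x in Ω, (c • w.2 i) x * φ x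
    rw [key, key, hw']
    ring

/-- The space of all pairs `(φ, ∇φ)` with `φ ∈ C_c^∞(Ω)`. -/
noncomputable def testPairs {d : ℕ} (Ω : Set (Space d)) :
    Submodule ℂ (L2 Ω × (Fin d → L2 Ω)) where
  carrier := {w | ∃ φ : Space d → ℂ, IsTestFunction Ω φ ∧
    w.1 =ᵐ[volume.restrict Ω] φ ∧ ∀ i, w.2 i =ᵐ[volume.restrict Ω] partialDeriv i φ}
  zero_mem' := by
    refine ⟨0, IsTestFunction.zero, Lp.coeFn_zero _ _ _, fun i => ?_⟩
    have : partialDeriv i (0 : Space d → ℂ) = 0 := by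
      funext x
      simp [partialDeriv]
    rw [this]
    exact Lp.coeFn_zero _ _ _
  add_mem' := by
    rintro v w ⟨φ, hφ, h1, h2⟩ ⟨ψ, hψ, h3, h4⟩
    refine ⟨φ + ψ, hφ.add hψ, (Lp.coeFn_add _ _).trans (h1.add h3), fun i => ?_⟩
    rw [hφ.partialDeriv_add hψ]
    exact (Lp.coeFn_add _ _).trans ((h2 i).add (h4 i))
  smul_mem' := by
    rintro c w ⟨φ, hφ, h1, h2⟩
    refine ⟨c • φ, hφ.smul c, (Lp.coeFn_smul _ _).trans (h1.const_smul c), fun i => ?_⟩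
    rw [hφ.partialDeriv_smul]
    exact (Lp.coeFn_smul _ _).trans ((h2 i).const_smul c)

/-- The Sobolev space `H₀¹(Ω)`: the closure of `C_c^∞(Ω)` in `H¹(Ω)`; again its elements are the
pairs `(u, ∇u)`, and the topology of `L²(Ω) × L²(Ω)^d` on such pairs is that of the `H¹`-norm. -/
noncomputable def sobolevH10 {d : ℕ} (Ω : Set (Space d)) :
    Submodule ℂ (L2 Ω × (Fin d → L2 Ω)) :=
  sobolevH1 Ω ⊓ (testPairs Ω).topologicalClosure

/-- The integrand `a_{ij} gᵢ \overline{hⱼ}` of the sesquilinear form. -/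
noncomputable def formIntegrand {d : ℕ} {Ω : Set (Space d)} (a : Fin d → Fin d → Space d → ℝ)
    (g h : Fin d → L2 Ω) (i j : Fin d) (x : Space d) : ℂ :=
  (a i j x : ℂ) * g i x * (starRingEnd ℂ) (h j x)

/-- The sesquilinear form `a₀(u, v) = ∑ᵢⱼ ∫_Ω a_{ij} ∂ᵢu \overline{∂ⱼv} dx`, as a function of the
gradients `g = ∇u` and `h = ∇v`. -/
noncomputable def form {d : ℕ} {Ω : Set (Space d)} (a : Fin d → Fin d → Space d → ℝ)
    (g h : Fin d → L2 Ω) : ℂ :=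
  ∑ i, ∑ j, ∫ x in Ω, formIntegrand a g h i j x

/-- The graph of the operator generated by the form `a₀` on `H₀¹(Ω)`: all `(u, f)` with
`u ∈ H₀¹(Ω)`, `f ∈ L²(Ω)` and `a₀(u, v) = ⟨f, v⟩` for every `v ∈ H₀¹(Ω)`. (The inner product of
the library is linear in its second argument. The integrability clause is automatic for bounded
measurable coefficients; it makes the graph a subspace for any `a`.) -/
noncomputable def dirichletGraph {d : ℕ} (Ω : Set (Space d))
    (a : Fin d → Fin d → Space d → ℝ) : Submodule ℂ (L2 Ω × L2 Ω) where
  carrier := {w | ∃ g, (w.1, g) ∈ sobolevH10 Ω ∧ ∀ v h, (v, h) ∈ sobolevH10 Ω →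
    (∀ i j, Integrable (formIntegrand a g h i j) (volume.restrict Ω)) ∧
      form a g h = inner ℂ v w.2}
  zero_mem' := by
    refine ⟨0, Submodule.zero_mem _, fun v h _ => ?_⟩
    have h0 : ∀ i j, formIntegrand a (0 : Fin d → L2 Ω) h i j =ᵐ[volume.restrict Ω] 0 := by
      intro i j
      filter_upwards [Lp.coeFn_zero ℂ 2 ((volume : Measure (Space d)).restrict Ω)] with x hx
      simp only [formIntegrand, Pi.zero_apply, hx, mul_zero, zero_mul]
    refine ⟨fun i j => (integrable_zero _ _ _).congr (h0 i j).symm, ?_⟩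
    simp only [form, Prod.snd_zero, inner_zero_right]
    refine Finset.sum_eq_zero fun i _ => Finset.sum_eq_zero fun j _ => ?_
    rw [integral_congr_ae (h0 i j)]
    simp
  add_mem' := by
    rintro w w' ⟨g, hg, H⟩ ⟨g', hg', H'⟩
    refine ⟨g + g', Submodule.add_mem _ hg hg', fun v h hv => ?_⟩
    obtain ⟨I, E⟩ := H v h hv
    obtain ⟨I', E'⟩ := H' v h hv
    have h0 : ∀ i j, formIntegrand a (g + g') h i j =ᵐ[volume.restrict Ω]
        formIntegrand a g h i j + formIntegrand a g' h i j := by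
      intro i j
      filter_upwards [Lp.coeFn_add (g i) (g' i)] with x hx
      simp only [formIntegrand, Pi.add_apply, hx]
      ring
    refine ⟨fun i j => ((I i j).add (I' i j)).congr (h0 i j).symm, ?_⟩
    rw [Prod.snd_add, inner_add_right, ← E, ← E']
    simp only [form, ← Finset.sum_add_distrib]
    refine Finset.sum_congr rfl fun i _ => Finset.sum_congr rfl fun j _ => ?_
    rw [integral_congr_ae (h0 i j)]
    exact integral_add (I i j) (I' i j)
  smul_mem' := by
    rintro c w ⟨g, hg, H⟩
    refine ⟨c • g, Submodule.smul_mem _ c hg, fun v h hv => ?_⟩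
    obtain ⟨I, E⟩ := H v h hv
    have h0 : ∀ i j, formIntegrand a (c • g) h i j =ᵐ[volume.restrict Ω]
        fun x => c * formIntegrand a g h i j x := by
      intro i j
      filter_upwards [Lp.coeFn_smul c (g i)] with x hx
      simp only [formIntegrand, Pi.smul_apply, hx, smul_eq_mul]
      ring
    refine ⟨fun i j => ((I i j).const_mul c).congr (h0 i j).symm, ?_⟩
    rw [Prod.smul_snd, inner_smul_right, ← E]
    simp only [form, Finset.mul_sum]
    refine Finset.sum_congr rfl fun i _ => Finset.sum_congr rfl fun j _ => ?_
    rw [integral_congr_ae (h0 i j)]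
    exact integral_const_mul _ _

/-- The operator `A₀` in `L²(Ω)` generated by the form `a₀` on `H₀¹(Ω)`. -/
noncomputable def dirichletOperator {d : ℕ} (Ω : Set (Space d))
    (a : Fin d → Fin d → Space d → ℝ) : L2 Ω →ₗ.[ℂ] L2 Ω :=
  (dirichletGraph Ω a).toLinearPMap

/-- An `L²` function orthogonal to `C_c^∞(Ω)` vanishes. -/
theorem L2.eq_zero_of_forall_test {d : ℕ} {Ω : Set (Space d)} (hΩ : IsOpen Ω) (u : L2 Ω)
    (h : ∀ φ : Space d → ℂ, IsTestFunction Ω φ → ∫ x in Ω, u x * φ x = 0) : u = 0 := by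
  have hloc : LocallyIntegrable u (volume.restrict Ω) :=
    (Lp.memLp u).locallyIntegrable (by norm_num)
  have key := IsOpen.ae_eq_zero_of_integral_contDiff_smul_eq_zero (μ := volume.restrict Ω) hΩ
    (f := u) (hloc.locallyIntegrableOn Ω) (by
      intro g hg hgc hgs
      have ht : IsTestFunction Ω (fun x => (g x : ℂ)) := by
        refine ⟨Complex.ofRealCLM.contDiff.comp hg, hgc.comp_left Complex.ofReal_zero, ?_⟩
        refine (closure_mono fun x hx => ?_).trans hgs
        simpa using hx
      have := h _ ht
      rw [← this]
      refine integral_congr_ae (Filter.Eventually.of_forall fun x => ?_)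
      simp [mul_comm])
  rw [Lp.eq_zero_iff_ae_eq_zero]
  filter_upwards [key, ae_restrict_mem hΩ.measurableSet] with x hx hxΩ using hx hxΩ

/-- Integration by parts: a test function with its gradient is an element of `H₀¹(Ω)`. -/
theorem IsTestFunction.mem_sobolevH10 {d : ℕ} {Ω : Set (Space d)}
    {φ : Space d → ℂ} (hφ : IsTestFunction Ω φ) :
    ((hφ.memLp 2 (volume.restrict Ω)).toLp φ,
      fun i => (hφ.memLp_partialDeriv i 2 (volume.restrict Ω)).toLp (partialDeriv i φ))
        ∈ sobolevH10 Ω := by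
  refine ⟨fun ψ hψ i => ?_, Submodule.le_topologicalClosure _
    ⟨φ, hφ, (hφ.memLp 2 _).coeFn_toLp, fun i => (hφ.memLp_partialDeriv i 2 _).coeFn_toLp⟩⟩
  have hint : ∀ {f g : Space d → ℂ}, MemLp f 2 volume → MemLp g 2 volume →
      Integrable (fun x => f x * g x) volume := fun hf hg => hf.integrable_mul hg
  have e1 : ∫ x in Ω, ((hφ.memLp 2 (volume.restrict Ω)).toLp φ) x * partialDeriv i ψ x
      = ∫ x, φ x * partialDeriv i ψ x := by
    rw [← setIntegral_eq_integral_of_forall_compl_eq_zero (s := Ω)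
      (f := fun x => φ x * partialDeriv i ψ x)]
    · refine integral_congr_ae ?_
      filter_upwards [MemLp.coeFn_toLp (hφ.memLp 2 (volume.restrict Ω))] with x hx
      rw [hx]
    · intro x hx
      have : partialDeriv i ψ x = 0 := by
        by_contra h
        exact hx (hψ.support_partialDeriv i h)
      simp [this]
  have e2 : ∫ x in Ω, ((hφ.memLp_partialDeriv i 2 (volume.restrict Ω)).toLp
      (partialDeriv i φ)) x * ψ x = ∫ x, partialDeriv i φ x * ψ x := by
    rw [← setIntegral_eq_integral_of_forall_compl_eq_zero (s := Ω)
      (f := fun x => partialDeriv i φ x * ψ x)]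
    · refine integral_congr_ae ?_
      filter_upwards [MemLp.coeFn_toLp (hφ.memLp_partialDeriv i 2 (volume.restrict Ω))] with x hx
      rw [hx]
    · intro x hx
      have : partialDeriv i φ x = 0 := by
        by_contra h
        exact hx (hφ.support_partialDeriv i h)
      simp [this]
  change ∫ x in Ω, ((hφ.memLp 2 (volume.restrict Ω)).toLp φ) x * partialDeriv i ψ x
    = -∫ x in Ω, ((hφ.memLp_partialDeriv i 2 (volume.restrict Ω)).toLp
      (partialDeriv i φ)) x * ψ x
  rw [e1, e2]
  exact integral_mul_fderiv_eq_neg_fderiv_mul_of_integrable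
    (hint (hφ.memLp_partialDeriv i 2 _) (hψ.memLp 2 _))
    (hint (hφ.memLp 2 _) (hψ.memLp_partialDeriv i 2 _))
    (hint (hφ.memLp 2 _) (hψ.memLp 2 _))
    (fun x _ => hφ.differentiable x) (fun x _ => hψ.differentiable x)

/-- The weak gradient is unique. -/
theorem sobolevH1_gradient_eq_zero {d : ℕ} {Ω : Set (Space d)} (hΩ : IsOpen Ω)
    {g : Fin d → L2 Ω} (hg : ((0 : L2 Ω), g) ∈ sobolevH1 Ω) : g = 0 := by
  funext i
  refine L2.eq_zero_of_forall_test hΩ (g i) fun φ hφ => ?_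
  have h1 := hg φ hφ i
  have h2 : ∫ x in Ω, (0 : L2 Ω) x * partialDeriv i φ x = 0 := by
    rw [integral_congr_ae (g := fun _ => 0)]
    · simp
    · filter_upwards [Lp.coeFn_zero ℂ 2 ((volume : Measure (Space d)).restrict Ω)] with x hx
      rw [hx, Pi.zero_apply, zero_mul]
  exact neg_eq_zero.mp (h1.symm.trans h2)

/-- `dirichletGraph` is single-valued, hence it is the graph of `dirichletOperator`. -/
theorem dirichletOperator_graph {d : ℕ} {Ω : Set (Space d)} (hΩ : IsOpen Ω)
    (a : Fin d → Fin d → Space d → ℝ) :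
    (dirichletOperator Ω a).graph = dirichletGraph Ω a := by
  refine Submodule.toLinearPMap_graph_eq _ ?_
  rintro ⟨u, f⟩ ⟨g, hg, H⟩ (rfl : u = 0)
  have hg0 : g = 0 := sobolevH1_gradient_eq_zero hΩ hg.1
  subst hg0
  refine L2.eq_zero_of_forall_test hΩ f fun φ hφ => ?_
  have hφ' : IsTestFunction Ω (fun x => (starRingEnd ℂ) (φ x)) :=
    ⟨Complex.conjCLE.contDiff.comp hφ.smooth, hφ.compact.comp_left (map_zero _),
      (closure_mono fun x hx => by simpa using hx).trans hφ.support_subset⟩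
  have h1 := (H _ _ hφ'.mem_sobolevH10).2
  have h2 : form a (0 : Fin d → L2 Ω)
      (fun i => (hφ'.memLp_partialDeriv i 2 _).toLp (partialDeriv i _)) = 0 := by
    refine Finset.sum_eq_zero fun i _ => Finset.sum_eq_zero fun j _ => ?_
    rw [integral_congr_ae (g := fun _ => 0)]
    · simp
    · filter_upwards [Lp.coeFn_zero ℂ 2 ((volume : Measure (Space d)).restrict Ω)] with x hx
      simp only [formIntegrand, Pi.zero_apply, hx, mul_zero, zero_mul]
  rw [h2, L2.inner_def] at h1
  rw [h1]
  refine integral_congr_ae ?_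
  filter_upwards [MemLp.coeFn_toLp (hφ'.memLp 2 (volume.restrict Ω))] with x hx
  simp [hx, RCLike.inner_apply]

/-- The natural domain `{u ∈ L²(Ω) : m u ∈ L²(Ω)}` of the multiplication by the function `m`. -/
noncomputable def multiplicationDomain {d : ℕ} (Ω : Set (Space d)) (m : Space d → ℂ) :
    Submodule ℂ (L2 Ω) where
  carrier := {u | MemLp (fun x => m x * u x) 2 (volume.restrict Ω)}
  zero_mem' := by
    refine (MemLp.zero : MemLp (0 : Space d → ℂ) 2 (volume.restrict Ω)).ae_eq ?_
    filter_upwards [Lp.coeFn_zero ℂ 2 ((volume : Measure (Space d)).restrict Ω)] with x hx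
    rw [hx, Pi.zero_apply, mul_zero]
  add_mem' := by
    intro u v hu hv
    refine (MemLp.add hu hv).ae_eq ?_
    filter_upwards [Lp.coeFn_add u v] with x hx
    rw [hx, Pi.add_apply, Pi.add_apply, mul_add]
  smul_mem' := by
    intro c u hu
    refine (MemLp.const_smul hu c).ae_eq ?_
    filter_upwards [Lp.coeFn_smul c u] with x hx
    rw [hx, Pi.smul_apply, Pi.smul_apply, smul_eq_mul, smul_eq_mul]
    ring

theorem mem_multiplicationDomain {d : ℕ} {Ω : Set (Space d)} {m : Space d → ℂ} {u : L2 Ω} :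
    u ∈ multiplicationDomain Ω m ↔ MemLp (fun x => m x * u x) 2 (volume.restrict Ω) :=
  Iff.rfl

/-- Multiplication by the function `m` as an operator in `L²(Ω)`, with its natural domain. -/
noncomputable def multiplication {d : ℕ} (Ω : Set (Space d)) (m : Space d → ℂ) :
    L2 Ω →ₗ.[ℂ] L2 Ω where
  domain := multiplicationDomain Ω m
  toFun :=
    { toFun := fun u => MemLp.toLp (fun x => m x * (u : L2 Ω) x) (mem_multiplicationDomain.mp u.2)
      map_add' := by
        rintro ⟨u, hu⟩ ⟨v, hv⟩
        refine Lp.ext ?_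
        refine (MemLp.coeFn_toLp _).trans (Filter.EventuallyEq.trans ?_ (Lp.coeFn_add _ _).symm)
        filter_upwards [Lp.coeFn_add u v, MemLp.coeFn_toLp (mem_multiplicationDomain.mp hu),
          MemLp.coeFn_toLp (mem_multiplicationDomain.mp hv)] with x hx h1 h2
        rw [Pi.add_apply, h1, h2, ← mul_add]
        exact congrArg (m x * ·) hx
      map_smul' := by
        rintro c ⟨u, hu⟩
        refine Lp.ext ?_
        refine (MemLp.coeFn_toLp _).trans (Filter.EventuallyEq.trans ?_ (Lp.coeFn_smul _ _).symm)
        filter_upwards [Lp.coeFn_smul c u,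
          MemLp.coeFn_toLp (mem_multiplicationDomain.mp hu)] with x hx h1
        rw [Pi.smul_apply, RingHom.id_apply, h1, smul_eq_mul, mul_left_comm]
        exact congrArg (m x * ·) hx }

/-- `A_q = A₀ + q`. (The domain of a sum of operators is the intersection of the domains.) -/
noncomputable def schrodingerOperator {d : ℕ} (Ω : Set (Space d))
    (a : Fin d → Fin d → Space d → ℝ) (q : Space d → ℝ) : L2 Ω →ₗ.[ℂ] L2 Ω :=
  dirichletOperator Ω a + multiplication Ω (fun x => (q x : ℂ))

/-- `A_q + ρ(x) p^{α(x)}`, with the principal branch of the power. -/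
noncomputable def pencil {d : ℕ} (Ω : Set (Space d)) (a : Fin d → Fin d → Space d → ℝ)
    (q ρ α : Space d → ℝ) (p : ℂ) : L2 Ω →ₗ.[ℂ] L2 Ω :=
  schrodingerOperator Ω a q + multiplication Ω (fun x => (ρ x : ℂ) * p ^ (α x : ℂ))

/-- `A_q + ρ(x) r^{α(x)} e^{iβα(x)}`. -/
noncomputable def polarPencil {d : ℕ} (Ω : Set (Space d)) (a : Fin d → Fin d → Space d → ℝ)
    (q ρ α : Space d → ℝ) (r β : ℝ) : L2 Ω →ₗ.[ℂ] L2 Ω :=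
  schrodingerOperator Ω a q + multiplication Ω
    (fun x => (ρ x : ℂ) * ((r ^ α x : ℝ) : ℂ) * Complex.exp (Complex.I * (β : ℂ) * (α x : ℂ)))

/-- The bounded operator `R`, defined on the whole Hilbert space, is the (two-sided) inverse of
the unbounded operator `T`. -/
def IsBoundedInverse {H : Type*} [NormedAddCommGroup H] [NormedSpace ℂ H]
    (T : H →ₗ.[ℂ] H) (R : H →L[ℂ] H) : Prop :=
  (∀ f : H, ∃ h : R f ∈ T.domain, T ⟨R f, h⟩ = f) ∧ ∀ u : T.domain, R (T u) = u

/-- `θ_*(r) = α_M⁻¹ min_{σ = ±1} arctan (ρ₀ / (3 ρ_M) · r^{σ (α_M - α₀)})`. -/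
noncomputable def thetaStar (α₀ αM ρ₀ ρM r : ℝ) : ℝ :=
  αM⁻¹ * min (Real.arctan (ρ₀ / (3 * ρM) * r ^ (αM - α₀)))
    (Real.arctan (ρ₀ / (3 * ρM) * r ^ (-(αM - α₀))))

/-- `c_*(β) = max_{j = 0, M} |sin (α_j β)|⁻¹`. -/
noncomputable def cStar (α₀ αM β : ℝ) : ℝ :=
  max |Real.sin (α₀ * β)|⁻¹ |Real.sin (αM * β)|⁻¹

open Classical in
/-- `C(r, β)` is `2 ρ₀⁻¹` if `|β| ≤ θ_*(r)` and `ρ₀⁻¹ c_*(β)` otherwise. -/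
noncomputable def resolventConst (α₀ αM ρ₀ ρM r β : ℝ) : ℝ :=
  if |β| ≤ thetaStar α₀ αM ρ₀ ρM r then 2 * ρ₀⁻¹ else ρ₀⁻¹ * cStar α₀ αM β

end VariableOrder

/-! The resolvent is built by the form method. Let `V` be `H₀¹(Ω)`, `J` its embedding into `L²(Ω)`,
and `S` the bounded operator on `V` that represents the form of `A_q`. For a bounded multiplication
operator `M` on `L²`, the inverse of `A_q + M` is `J (S + J* M J)⁻¹ J*`, so everything reduces to
inverting one bounded operator on `V`. By ellipticity, Poincaré's inequality and `q ≥ 0`, the form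
of `S` is real and coercive. That `q` maps `H₀¹` boundedly into `L²`, and hence does not shrink the
domain of `A₀`, follows from Hölder's and Sobolev's inequalities; no regularity of the boundary or
of the solution enters.

With `z = log p` and `β = Im z`, the symbol is `ρ e^{zα}`, of argument `αβ`. Multiply the equation
by `e^{-iφ}`: the form contributes `cos φ` times its coercive real part, the symbol contributes `ρ
e^{α Re z} cos(αβ - φ)`. The choice `φ = β α_M / 2`, the middle of the possible arguments, makes the
second term nonnegative and keeps `cos φ ≥ cos(π α_M / 2) > 0`. This gives invertibility and a bound
uniform in `p` (`isUnit_and_norm_formResolvent_le`). The explicit bound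
(`norm_formResolvent_le_resolventConst`) uses the symbol instead: `φ = 0` for small `β`, otherwise
`φ = ±π/2`, for which the form drops out and concavity of the sine gives `c_*`.

Holomorphy holds because `z ↦ ρ e^{zα}` is entire with values in `L^∞` and inversion is
differentiable at units. -/

namespace VariableOrder

/-! ### Multiplication operators and the symbol `ρ e^{zα}` in `L^∞` -/

section Multiplication

variable {X : Type*} [MeasurableSpace X] {μ : Measure X}

/-- Multiplication by an essentially bounded function, as a bounded operator in `L²`. -/
noncomputable def mulL (μ : Measure X) : Lp ℂ ∞ μ →L[ℂ] Lp ℂ 2 μ →L[ℂ] Lp ℂ 2 μ :=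
  (ContinuousLinearMap.mul ℂ ℂ).holderL μ ∞ 2 2

theorem coeFn_mulL {m : X → ℂ} (hm : MemLp m ∞ μ) (u : Lp ℂ 2 μ) :
    mulL μ (hm.toLp m) u =ᵐ[μ] fun x => m x * u x := by
  refine ((ContinuousLinearMap.mul ℂ ℂ).coeFn_holder (r := 2) (hm.toLp m) u).trans ?_
  filter_upwards [hm.coeFn_toLp] with x hx
  simp [hx]

theorem memLp_mul {m : X → ℂ} (hm : MemLp m ∞ μ) (u : Lp ℂ 2 μ) :
    MemLp (fun x => m x * u x) 2 μ :=
  (Lp.memLp (mulL μ (hm.toLp m) u)).ae_eq (coeFn_mulL hm u)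

theorem norm_sq_eq_integral (w : Lp ℂ 2 μ) : ‖w‖ ^ 2 = ∫ x, ‖w x‖ ^ 2 ∂μ := by
  have h := inner_self_eq_norm_sq_to_K (𝕜 := ℂ) w
  rw [L2.inner_def] at h
  have h2 : ∫ x, (inner ℂ (w x) (w x) : ℂ) ∂μ = ((∫ x, ‖w x‖ ^ 2 ∂μ : ℝ) : ℂ) := by
    rw [← integral_complex_ofReal]
    refine integral_congr_ae (Filter.Eventually.of_forall fun x => ?_)
    simp [inner_self_eq_norm_sq_to_K]
  rw [h2] at h
  have h3 := congrArg Complex.re h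
  rw [Complex.ofReal_re] at h3
  rw [h3]
  norm_cast

theorem integrable_norm_sq (w : Lp ℂ 2 μ) : Integrable (fun x => ‖w x‖ ^ 2) μ :=
  (Lp.memLp w).integrable_norm_pow (by norm_num)

theorem inner_eq_integral (v w : Lp ℂ 2 μ) {g : X → ℂ} (hg : w =ᵐ[μ] g) :
    inner ℂ v w = ∫ x, g x * (starRingEnd ℂ) (v x) ∂μ := by
  rw [L2.inner_def]
  refine integral_congr_ae ?_
  filter_upwards [hg] with x hx
  rw [hx, RCLike.inner_apply]

theorem integrable_mul_conj (v w : Lp ℂ 2 μ) {g : X → ℂ} (hg : w =ᵐ[μ] g) :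
    Integrable (fun x => g x * (starRingEnd ℂ) (v x)) μ := by
  refine (L2.integrable_inner (𝕜 := ℂ) v w).congr ?_
  filter_upwards [hg] with x hx
  rw [hx, RCLike.inner_apply]

/-- Lower bound of the numerical range of a multiplication operator. -/
theorem le_re_inner_mul {m : X → ℂ} {u w : Lp ℂ 2 μ} (hu : u =ᵐ[μ] fun x => m x * w x)
    (c : ℂ) (b : ℝ) (hb : ∀ᵐ x ∂μ, b ≤ (c * m x).re) :
    b * ‖w‖ ^ 2 ≤ (c * inner ℂ w u).re := by
  rw [inner_eq_integral w u hu, norm_sq_eq_integral, ← integral_const_mul, ← integral_const_mul]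
  have hi : Integrable (fun x => c * (m x * w x * (starRingEnd ℂ) (w x))) μ :=
    (integrable_mul_conj w u hu).const_mul c
  have e : (∫ x, c * (m x * w x * (starRingEnd ℂ) (w x)) ∂μ).re
      = ∫ x, (c * (m x * w x * (starRingEnd ℂ) (w x))).re ∂μ := (integral_re hi).symm
  rw [e]
  refine integral_mono_ae ((integrable_norm_sq w).const_mul b) hi.re ?_
  filter_upwards [hb] with x hx
  have : c * (m x * w x * (starRingEnd ℂ) (w x)) = (c * m x) * ((‖w x‖ ^ 2 : ℝ) : ℂ) := by
    rw [mul_assoc, Complex.mul_conj, Complex.normSq_eq_norm_sq]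
    ring
  simp only [this]
  rw [Complex.re_mul_ofReal]
  exact mul_le_mul_of_nonneg_right hx (by positivity)

theorem memLp_mul_exp {α ρ : X → ℝ} (hα : MemLp α ∞ μ) (hρ : MemLp ρ ∞ μ) (z : ℂ) :
    MemLp (fun x => (ρ x : ℂ) * Complex.exp (z * α x)) ∞ μ := by
  have h1 : MemLp (fun x => Complex.exp (z * α x)) ∞ μ := by
    refine memLp_top_of_bound ?_ (Real.exp (‖z‖ * (eLpNormEssSup α μ).toReal)) ?_
    · exact (by fun_prop : Continuous fun t : ℝ => Complex.exp (z * t)).comp_aestronglyMeasurable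
        hα.1
    · have hfin : eLpNormEssSup α μ ≠ ⊤ := by simpa using hα.2.ne
      filter_upwards [enorm_ae_le_eLpNormEssSup α μ] with x hx
      refine (Complex.norm_exp_le_exp_norm _).trans (Real.exp_le_exp.mpr ?_)
      rw [norm_mul]
      refine mul_le_mul_of_nonneg_left ?_ (norm_nonneg _)
      have := ENNReal.toReal_mono hfin hx
      simpa using this
  have h2 : MemLp (fun x => (ρ x : ℂ)) ∞ μ := hρ.ofReal
  exact MemLp.mul (p := ∞) (q := ∞) (r := ∞) h1 h2

/-- The function `ρ e^{zα}` as an element of `L^∞`. -/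
noncomputable def expSymbol {α ρ : X → ℝ} (hα : MemLp α ∞ μ) (hρ : MemLp ρ ∞ μ) (z : ℂ) :
    Lp ℂ ∞ μ :=
  (memLp_mul_exp hα hρ z).toLp _

theorem norm_le_of_ae_bound_top (f : Lp ℂ ∞ μ) {C : ℝ} (hC : 0 ≤ C)
    (h : ∀ᵐ x ∂μ, ‖f x‖ ≤ C) : ‖f‖ ≤ C := by
  rw [Lp.norm_def]
  refine ENNReal.toReal_le_of_le_ofReal hC ?_
  rw [eLpNorm_exponent_top]
  exact eLpNormEssSup_le_of_ae_bound h

/-- The pointwise Taylor estimate `|e^ζ - 1 - ζ| ≤ |ζ|²` at `ζ = (w - z) α(x)` is uniform in `x`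
because `|α| ≤ 1`, so the remainder is quadratic in the `L^∞` norm. The derivative is the same
symbol with `αρ` in place of `ρ`. -/
theorem differentiable_expSymbol {α ρ : X → ℝ} (hα : MemLp α ∞ μ) (hρ : MemLp ρ ∞ μ)
    (hα0 : ∀ᵐ x ∂μ, |α x| ≤ 1) {M : ℝ} (hρM : ∀ᵐ x ∂μ, |ρ x| ≤ M) :
    Differentiable ℂ (expSymbol hα hρ) := by
  intro z
  -- `M` may be negative if `μ = 0`; the norm bound below needs a nonnegative constant.
  have hM : ∀ᵐ x ∂μ, |ρ x| ≤ max M 0 := hρM.mono fun x hx => hx.trans (le_max_left _ _)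
  set K := max M 0
  have hK : 0 ≤ K := le_max_right _ _
  have hαρ : MemLp (fun x => α x * ρ x) ∞ μ := MemLp.mul (p := ∞) (q := ∞) (r := ∞) hρ hα
  refine HasDerivAt.differentiableAt (f' := expSymbol hα hαρ z) ?_
  rw [hasDerivAt_iff_isLittleO]
  refine Asymptotics.IsBigO.trans_isLittleO (g := fun w : ℂ => (w - z) ^ 2) ?_ ?_
  · refine Asymptotics.IsBigO.of_bound (K * Real.exp ‖z‖) ?_
    filter_upwards [Metric.ball_mem_nhds z one_pos] with w hw
    have hw1 : ‖w - z‖ < 1 := by simpa [dist_eq_norm] using hw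
    refine norm_le_of_ae_bound_top _ (by positivity) ?_
    filter_upwards [Lp.coeFn_sub (expSymbol hα hρ w - expSymbol hα hρ z)
        ((w - z) • expSymbol hα hαρ z), Lp.coeFn_sub (expSymbol hα hρ w) (expSymbol hα hρ z),
      Lp.coeFn_smul (w - z) (expSymbol hα hαρ z), (memLp_mul_exp hα hρ w).coeFn_toLp,
      (memLp_mul_exp hα hρ z).coeFn_toLp, (memLp_mul_exp hα hαρ z).coeFn_toLp, hα0, hM]
      with x h1 h2 h3 h4 h5 h6 h7 h8
    rw [h1, Pi.sub_apply, h2, h3, Pi.sub_apply, Pi.smul_apply]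
    unfold expSymbol
    rw [h4, h5, h6]
    have e : (ρ x : ℂ) * Complex.exp (w * α x) - ρ x * Complex.exp (z * α x)
        - (w - z) • (((α x * ρ x : ℝ) : ℂ) * Complex.exp (z * α x))
        = ρ x * Complex.exp (z * α x)
          * (Complex.exp ((w - z) * α x) - 1 - (w - z) * α x) := by
      have : w * (α x : ℂ) = z * α x + (w - z) * α x := by ring
      rw [this, Complex.exp_add, smul_eq_mul]
      push_cast
      ring
    rw [e, norm_mul, norm_mul, Complex.norm_real, Real.norm_eq_abs, norm_pow]
    have hn : ‖(w - z) * (α x : ℂ)‖ ≤ ‖w - z‖ := by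
      rw [norm_mul, Complex.norm_real, Real.norm_eq_abs]
      exact mul_le_of_le_one_right (norm_nonneg _) h7
    have b1 : ‖Complex.exp (z * α x)‖ ≤ Real.exp ‖z‖ := by
      refine (Complex.norm_exp_le_exp_norm _).trans (Real.exp_le_exp.mpr ?_)
      rw [norm_mul, Complex.norm_real, Real.norm_eq_abs]
      exact mul_le_of_le_one_right (norm_nonneg _) h7
    have b2 : ‖Complex.exp ((w - z) * α x) - 1 - (w - z) * α x‖ ≤ ‖w - z‖ ^ 2 :=
      (Complex.norm_exp_sub_one_sub_id_le (hn.trans hw1.le)).trans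
        (pow_le_pow_left₀ (norm_nonneg _) hn 2)
    gcongr
  · have h := Asymptotics.isLittleO_pow_sub_sub z (m := 2) (by norm_num)
    exact Asymptotics.isLittleO_norm_left.mp (by simpa only [norm_pow] using h)

end Multiplication

/-! ### Abstract form method: invertibility and resolvent bounds -/

section Resolvent

variable {V H : Type*} [NormedAddCommGroup V] [InnerProductSpace ℂ V] [CompleteSpace V]
  [NormedAddCommGroup H] [InnerProductSpace ℂ H] [CompleteSpace H]

/-- The operator `S + J* M J` on the form domain. -/
noncomputable def formOperator (J : V →L[ℂ] H) (S : V →L[ℂ] V) (M : H →L[ℂ] H) : V →L[ℂ] V :=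
  S + J.adjoint ∘L M ∘L J

/-- The resolvent `J (S + J* M J)⁻¹ J*` on the ambient space. -/
noncomputable def formResolvent (J : V →L[ℂ] H) (S : V →L[ℂ] V) (M : H →L[ℂ] H) : H →L[ℂ] H :=
  J ∘L Ring.inverse (formOperator J S M) ∘L J.adjoint

variable {J : V →L[ℂ] H} {S : V →L[ℂ] V} {M : H →L[ℂ] H} {c : ℝ}

theorem formOperator_inverse_apply (hU : IsUnit (formOperator J S M)) (v : V) :
    formOperator J S M (Ring.inverse (formOperator J S M) v) = v := by
  have := Ring.mul_inverse_cancel _ hU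
  exact congrArg (fun T : V →L[ℂ] V => T v) this

theorem inverse_formOperator_apply (hU : IsUnit (formOperator J S M)) (v : V) :
    Ring.inverse (formOperator J S M) (formOperator J S M v) = v := by
  have := Ring.inverse_mul_cancel _ hU
  exact congrArg (fun T : V →L[ℂ] V => T v) this

theorem formOperator_add_comp_apply (A : V →L[ℂ] V) (Q : V →L[ℂ] H) (u : V) :
    formOperator J (A + J.adjoint ∘L Q) M u = A u + J.adjoint (Q u + M (J u)) := by
  simp [formOperator, add_assoc]

theorem inner_add_comp_apply (A : V →L[ℂ] V) (Q : V →L[ℂ] H) (u v : V) :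
    inner ℂ v ((A + J.adjoint ∘L Q) u) = inner ℂ v (A u) + inner ℂ (J v) (Q u) := by
  simp [ContinuousLinearMap.adjoint_inner_right]

/-- Left-inverse half: `A u = J* f` is the weak form of the equation with right-hand side `f`, so
the argument of the resolvent is the perturbed operator applied to `J u`. -/
theorem formResolvent_add_comp_apply {A : V →L[ℂ] V} {Q : V →L[ℂ] H} {u : V} {f : H}
    (hU : IsUnit (formOperator J (A + J.adjoint ∘L Q) M)) (h : A u = J.adjoint f) :
    formResolvent J (A + J.adjoint ∘L Q) M (f + Q u + M (J u)) = J u := by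
  have h1 : J.adjoint (f + Q u + M (J u)) = formOperator J (A + J.adjoint ∘L Q) M u := by
    rw [formOperator_add_comp_apply, add_assoc, map_add, h]
  change J (Ring.inverse (formOperator J (A + J.adjoint ∘L Q) M) (J.adjoint _)) = J u
  rw [h1, inverse_formOperator_apply hU]

/-- Right-inverse half: moving the two perturbations to the right-hand side exhibits the resolvent's
value as a weak solution for the unperturbed form. -/
theorem exists_formResolvent_eq {A : V →L[ℂ] V} {Q : V →L[ℂ] H}
    (hU : IsUnit (formOperator J (A + J.adjoint ∘L Q) M)) (f : H) :
    ∃ u, formResolvent J (A + J.adjoint ∘L Q) M f = J u ∧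
      A u = J.adjoint (f - (Q u + M (J u))) := by
  refine ⟨Ring.inverse (formOperator J (A + J.adjoint ∘L Q) M) (J.adjoint f), rfl, ?_⟩
  have h := formOperator_inverse_apply hU (J.adjoint f)
  rw [formOperator_add_comp_apply] at h
  rw [map_sub]
  exact eq_sub_of_add_eq h

theorem inner_formOperator (u : V) :
    inner ℂ u (formOperator J S M u) = inner ℂ u (S u) + inner ℂ (J u) (M (J u)) := by
  simp [formOperator, ContinuousLinearMap.adjoint_inner_right]

/-- Since `⟨u, S u⟩` is real, the factor `l` acts on it through `Re l` alone, while the perturbation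
keeps its own lower bound `b`. -/
theorem le_re_mul_inner_formOperator (hS : ∀ u, (inner ℂ u (S u)).im = 0)
    (hc : ∀ u, c * ‖u‖ ^ 2 ≤ (inner ℂ u (S u)).re) {l : ℂ} (hl : 0 ≤ l.re) {b : ℝ}
    (hM : ∀ w, b * ‖w‖ ^ 2 ≤ (l * inner ℂ w (M w)).re) (u : V) :
    l.re * c * ‖u‖ ^ 2 + b * ‖J u‖ ^ 2 ≤ (l * inner ℂ u (formOperator J S M u)).re := by
  rw [inner_formOperator, mul_add, Complex.add_re, Complex.mul_re l (inner ℂ u (S u)), hS u,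
    mul_zero, sub_zero, mul_assoc]
  exact add_le_add (mul_le_mul_of_nonneg_left (hc u) hl) (hM _)

/-- Lax–Milgram after a rotation: multiplication by `l` makes the real part coercive, and `|⟨u, T
u⟩|` changes only by the factor `‖l‖`. -/
theorem isUnit_formOperator (hS : ∀ u, (inner ℂ u (S u)).im = 0) (hc0 : 0 < c)
    (hc : ∀ u, c * ‖u‖ ^ 2 ≤ (inner ℂ u (S u)).re) {l : ℂ} (hl : 0 < l.re)
    (hM : ∀ w, 0 ≤ (l * inner ℂ w (M w)).re) : IsUnit (formOperator J S M) := by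
  have hl0 : 0 < ‖l‖ := norm_pos_iff.mpr (by rintro rfl; simp at hl)
  have hpos : 0 < ‖l‖⁻¹ * (l.re * c) := by positivity
  refine ContinuousLinearMap.isUnit_of_forall_le_norm_inner_map _
    (c := (‖l‖⁻¹ * (l.re * c)).toNNReal) (Real.toNNReal_pos.mpr hpos) fun u => ?_
  have h := le_re_mul_inner_formOperator (J := J) (M := M) hS hc hl.le (b := 0)
    (by simpa using hM) u
  have h2 : l.re * c * ‖u‖ ^ 2 ≤ ‖l‖ * ‖inner ℂ u (formOperator J S M u)‖ := by
    rw [← norm_mul]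
    refine le_trans ?_ (h.trans (Complex.re_le_norm _))
    simp
  rw [Real.coe_toNNReal _ hpos.le, norm_inner_symm]
  calc ‖u‖ ^ 2 * (‖l‖⁻¹ * (l.re * c)) = ‖l‖⁻¹ * (l.re * c * ‖u‖ ^ 2) := by ring
    _ ≤ ‖l‖⁻¹ * (‖l‖ * ‖inner ℂ u (formOperator J S M u)‖) := by gcongr
    _ = _ := by field_simp

/-- Test the equation `(S + J* M J) u = J* f` with `u` itself: the right-hand side becomes `⟨J u,
f⟩`, and Cauchy–Schwarz applies. -/
theorem energy_le (hU : IsUnit (formOperator J S M)) (hS : ∀ u, (inner ℂ u (S u)).im = 0)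
    (hc : ∀ u, c * ‖u‖ ^ 2 ≤ (inner ℂ u (S u)).re) {l : ℂ} (hl : 0 ≤ l.re) {b : ℝ}
    (hM : ∀ w, b * ‖w‖ ^ 2 ≤ (l * inner ℂ w (M w)).re) (f : H) :
    l.re * c * ‖Ring.inverse (formOperator J S M) (J.adjoint f)‖ ^ 2
      + b * ‖formResolvent J S M f‖ ^ 2 ≤ ‖l‖ * (‖formResolvent J S M f‖ * ‖f‖) := by
  refine (le_re_mul_inner_formOperator hS hc hl hM _).trans ((Complex.re_le_norm _).trans ?_)
  rw [norm_mul, formOperator_inverse_apply hU, ContinuousLinearMap.adjoint_inner_right]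
  exact mul_le_mul_of_nonneg_left (norm_inner_le_norm _ _) (norm_nonneg _)

/-- Resolvent bound from a lower bound of the numerical range of `M`. -/
theorem norm_formResolvent_le_div (hU : IsUnit (formOperator J S M))
    (hS : ∀ u, (inner ℂ u (S u)).im = 0) (hc0 : 0 ≤ c)
    (hc : ∀ u, c * ‖u‖ ^ 2 ≤ (inner ℂ u (S u)).re) {l : ℂ} (hl : 0 ≤ l.re) {b : ℝ} (hb : 0 < b)
    (hM : ∀ w, b * ‖w‖ ^ 2 ≤ (l * inner ℂ w (M w)).re) :
    ‖formResolvent J S M‖ ≤ ‖l‖ / b := by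
  refine ContinuousLinearMap.opNorm_le_bound _ (by positivity) fun f => ?_
  have h := energy_le hU hS hc hl hM f
  -- The form term is only discarded, so `Re l = 0` is allowed; the rotations by `±π/2` rely on
  -- this.
  have h0 : 0 ≤ l.re * c * ‖Ring.inverse (formOperator J S M) (J.adjoint f)‖ ^ 2 := by positivity
  set x := ‖formResolvent J S M f‖
  rcases (norm_nonneg (formResolvent J S M f)).eq_or_lt with hx | hx
  · change x ≤ _
    rw [show x = 0 from hx.symm]
    positivity
  · have : b * x ≤ ‖l‖ * ‖f‖ := le_of_mul_le_mul_right (by nlinarith) hx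
    rw [div_mul_eq_mul_div, le_div_iff₀ hb]
    linarith

/-- Resolvent bound from the coercivity of the form. -/
theorem norm_formResolvent_le_of_coercive (hJ : ‖J‖ ≤ 1) (hU : IsUnit (formOperator J S M))
    (hS : ∀ u, (inner ℂ u (S u)).im = 0) (hc0 : 0 < c)
    (hc : ∀ u, c * ‖u‖ ^ 2 ≤ (inner ℂ u (S u)).re) {l : ℂ} (hl : 0 < l.re)
    (hM : ∀ w, 0 ≤ (l * inner ℂ w (M w)).re) :
    ‖formResolvent J S M‖ ≤ ‖l‖ / (l.re * c) := by
  refine ContinuousLinearMap.opNorm_le_bound _ (by positivity) fun f => ?_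
  have h := energy_le hU hS hc hl.le (b := 0) (by simpa using hM) f
  set u := Ring.inverse (formOperator J S M) (J.adjoint f)
  have hx : ‖formResolvent J S M f‖ ≤ ‖u‖ :=
    (J.le_opNorm u).trans (mul_le_of_le_one_left (norm_nonneg _) hJ)
  set x := ‖formResolvent J S M f‖
  have hb : 0 < l.re * c := by positivity
  have hx0 : 0 ≤ x := norm_nonneg _
  rcases hx0.eq_or_lt with h0 | h0
  · rw [← h0]
    positivity
  · have hsq : l.re * c * x ^ 2 ≤ l.re * c * ‖u‖ ^ 2 := by gcongr
    have : l.re * c * x ≤ ‖l‖ * ‖f‖ := le_of_mul_le_mul_right (by nlinarith) h0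
    rw [div_mul_eq_mul_div, le_div_iff₀ hb]
    linarith

end Resolvent

/-! ### Sobolev's inequality for the potential and its extension to `H₀¹(Ω)` -/

variable {d : ℕ} {Ω : Set (Space d)}

/-- Sobolev's inequality is applied to the full derivative, whereas the `H¹` norm sees the partial
derivatives. -/
theorem norm_fderiv_le_sum_partialDeriv (φ : Space d → ℂ) (x : Space d) :
    ‖fderiv ℝ φ x‖ ≤ ∑ i, ‖partialDeriv i φ x‖ := by
  refine ContinuousLinearMap.opNorm_le_bound _ (Finset.sum_nonneg fun _ _ => norm_nonneg _)
    fun v => ?_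
  have hv : v = ∑ i, v i • EuclideanSpace.single i (1 : ℝ) := by
    ext j
    simp [Finset.sum_apply, Pi.single_apply]
  conv_lhs => rw [hv, map_sum]
  rw [Finset.sum_mul]
  refine (norm_sum_le _ _).trans (Finset.sum_le_sum fun i _ => ?_)
  rw [map_smul, norm_smul, mul_comm]
  exact mul_le_mul_of_nonneg_left (PiLp.norm_apply_le v i) (norm_nonneg _)

theorem eLpNorm_fderiv_le_sum {φ : Space d → ℂ} (hφ : IsTestFunction Ω φ) {p : ℝ≥0∞}
    (hp : 1 ≤ p) (μ : Measure (Space d)) :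
    eLpNorm (fderiv ℝ φ) p μ ≤ ∑ i, eLpNorm (partialDeriv i φ) p μ := by
  have h1 : eLpNorm (fderiv ℝ φ) p μ
      ≤ eLpNorm (∑ i, fun x => ‖partialDeriv i φ x‖) p μ := by
    refine eLpNorm_mono_real fun x => ?_
    simpa [Finset.sum_apply] using norm_fderiv_le_sum_partialDeriv φ x
  refine h1.trans ((eLpNorm_sum_le (fun i _ => ?_) hp).trans_eq ?_)
  · exact (hφ.continuous_partialDeriv i).norm.aestronglyMeasurable
  · exact Finset.sum_congr rfl fun i _ => eLpNorm_norm _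

/-- Sobolev's inequality for a potential in `L^κ`, `κ > d`, and test functions. -/
theorem exists_eLpNorm_mul_test_le (hd : 2 ≤ d) (hb : Bornology.IsBounded Ω)
    {κ : ℝ≥0∞} (hκ : (d : ℝ≥0∞) < κ) {q : Space d → ℂ} (hq : MemLp q κ (volume.restrict Ω)) :
    ∃ C : ℝ≥0∞, C ≠ ⊤ ∧ ∀ φ : Space d → ℂ, IsTestFunction Ω φ →
      eLpNorm (fun x => q x * φ x) 2 (volume.restrict Ω)
        ≤ C * ∑ i, eLpNorm (partialDeriv i φ) 2 (volume.restrict Ω) := by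
  have hd0 : (0 : ℝ) < d := by positivity
  have hd2 : (d : ℝ)⁻¹ ≤ 2⁻¹ := inv_anti₀ (by norm_num) (by exact_mod_cast hd)
  have hκ0 : κ ≠ 0 := (bot_le.trans_lt hκ).ne'
  have hκi : κ⁻¹ ≠ ⊤ := ENNReal.inv_ne_top.mpr hκ0
  set k : ℝ := κ⁻¹.toReal with hk
  have hk0 : 0 ≤ k := ENNReal.toReal_nonneg
  have hkd : k < (d : ℝ)⁻¹ := by
    have h := (ENNReal.toReal_lt_toReal hκi (by
      simp only [ne_eq, ENNReal.inv_eq_top, Nat.cast_eq_zero]; omega)).mpr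
      (ENNReal.inv_lt_inv.mpr hκ)
    rwa [ENNReal.toReal_inv (d : ℝ≥0∞), ENNReal.toReal_natCast] at h
  -- With `k = 1/κ`, the exponents solve `1/2 = 1/κ + 1/s` (Hölder) and `1/p = 1/s + 1/d` (Sobolev).
  -- From `κ > d ≥ 2` follow `s < ∞` and `1 ≤ p < 2 ≤ d`, so the critical case `p = d` does not
  -- occur even for `d = 2`.
  set s : NNReal := (1 / 2 - k)⁻¹.toNNReal with hs
  set p : NNReal := (1 / 2 + (d : ℝ)⁻¹ - k)⁻¹.toNNReal with hp
  have hs' : (s : ℝ) = (1 / 2 - k)⁻¹ := Real.coe_toNNReal _ (inv_nonneg.mpr (by linarith))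
  have hp' : (p : ℝ) = (1 / 2 + (d : ℝ)⁻¹ - k)⁻¹ :=
    Real.coe_toNNReal _ (inv_nonneg.mpr (by linarith))
  have hp1 : 1 ≤ p := by
    rw [← NNReal.coe_le_coe, hp', NNReal.coe_one]
    exact (one_le_inv₀ (by linarith)).mpr (by linarith)
  have hp2 : (p : ℝ) < 2 := by
    rw [hp', inv_lt_comm₀ (by linarith) (by norm_num)]
    linarith
  have hpd : p < Module.finrank ℝ (Space d) := by
    rw [finrank_euclideanSpace_fin, ← NNReal.coe_lt_coe]
    have : (2 : ℝ) ≤ d := by exact_mod_cast hd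
    simpa using hp2.trans_le this
  have hps : (p : ℝ)⁻¹ - (Module.finrank ℝ (Space d) : ℝ)⁻¹ ≤ (s : ℝ)⁻¹ := by
    rw [finrank_euclideanSpace_fin, hp', hs', inv_inv, inv_inv]
    linarith
  have : ENNReal.HolderTriple κ s 2 := by
    constructor
    have hsp : (0 : ℝ) < s := by rw [hs']; exact inv_pos.mpr (by linarith)
    have hs0 : s ≠ 0 := by
      intro h
      simp [h] at hsp
    have e : ((s : ℝ≥0∞))⁻¹ = ENNReal.ofReal (1 / 2 - k) := by
      rw [← ENNReal.coe_inv hs0, ← ENNReal.ofReal_coe_nnreal, NNReal.coe_inv, hs', inv_inv]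
    rw [e, ← ENNReal.ofReal_toReal hκi, ← hk, ← ENNReal.ofReal_add hk0 (by linarith)]
    rw [add_sub_cancel, one_div, ENNReal.ofReal_inv_of_pos (by norm_num)]
    norm_num
  have hfin : IsFiniteMeasure (volume.restrict Ω) :=
    ⟨by simpa using hb.measure_lt_top⟩
  -- The factor `|Ω|^{1/p - 1/2}` of the embedding of `L²` into `L^p` on the bounded set `Ω`.
  set D : ℝ≥0∞ := (volume.restrict Ω) Set.univ ^ (1 / (p : ℝ≥0∞).toReal - 1 / (2 : ℝ≥0∞).toReal)
    with hD
  have hDt : D ≠ ⊤ := by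
    refine ENNReal.rpow_ne_top_of_nonneg ?_ (measure_ne_top _ _)
    have hpp : (0 : ℝ) < p := by
      have : (1 : ℝ) ≤ p := by exact_mod_cast hp1
      linarith
    simp only [ENNReal.coe_toReal, ENNReal.toReal_ofNat, sub_nonneg]
    exact one_div_le_one_div_of_le hpp hp2.le
  refine ⟨eLpNorm q κ (volume.restrict Ω)
    * (eLpNormLESNormFDerivOfLeConst ℂ (volume : Measure (Space d)) Ω p s * D), ?_, ?_⟩
  · exact ENNReal.mul_ne_top hq.2.ne (ENNReal.mul_ne_top ENNReal.coe_ne_top hDt)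
  intro φ hφ
  have hsupp : Function.support φ ⊆ Ω := subset_closure.trans hφ.support_subset
  have h1 : eLpNorm (fun x => q x * φ x) 2 (volume.restrict Ω)
      ≤ eLpNorm q κ (volume.restrict Ω) * eLpNorm φ s (volume.restrict Ω) :=
    eLpNorm_smul_le_mul_eLpNorm (φ := q) (f := φ) hφ.smooth.continuous.aestronglyMeasurable hq.1
  have h2 : eLpNorm φ s (volume.restrict Ω) ≤ _ :=
    (eLpNorm_mono_measure _ Measure.restrict_le_self).trans
    (eLpNorm_le_eLpNorm_fderiv_of_le (volume : Measure (Space d)) (hφ.smooth.of_le (by simp))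
      hsupp hp1 hpd hps hb)
  have hsupp' : Function.support (fderiv ℝ φ) ⊆ Ω :=
    (support_fderiv_subset ℝ).trans hφ.support_subset
  have h3 : eLpNorm (fderiv ℝ φ) p volume ≤
      D * ∑ i, eLpNorm (partialDeriv i φ) 2 (volume.restrict Ω) := by
    have hr := eLpNorm_restrict_eq_of_support_subset (μ := volume) (p := (p : ℝ≥0∞))
      (f := fderiv ℝ φ) (s := Ω) (fun x hx => hsupp' hx)
    rw [← hr]
    refine (eLpNorm_le_eLpNorm_mul_rpow_measure_univ (q := 2) ?_ ?_).trans ?_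
    · rw [← ENNReal.coe_ofNat, ENNReal.coe_le_coe, ← NNReal.coe_le_coe]
      exact hp2.le
    · exact (hφ.smooth.continuous_fderiv (by simp)).aestronglyMeasurable
    · rw [mul_comm]
      exact mul_le_mul_right (eLpNorm_fderiv_le_sum hφ (by norm_num) _) D
  rw [mul_assoc, mul_assoc]
  refine h1.trans (mul_le_mul_right (h2.trans (mul_le_mul_right h3 _)) _)

/-- Multiplication by a potential that satisfies Sobolev's inequality for test functions maps
`H₀¹(Ω)` into `L²(Ω)`. -/
theorem eLpNorm_mul_le_of_mem_sobolevH10 {q : Space d → ℂ}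
    (hq : AEStronglyMeasurable q (volume.restrict Ω)) {C : ℝ≥0∞} (hC : C ≠ ⊤)
    (h : ∀ φ : Space d → ℂ, IsTestFunction Ω φ →
      eLpNorm (fun x => q x * φ x) 2 (volume.restrict Ω)
        ≤ C * ∑ i, eLpNorm (partialDeriv i φ) 2 (volume.restrict Ω))
    {w : L2 Ω × (Fin d → L2 Ω)} (hw : w ∈ sobolevH10 Ω) :
    eLpNorm (fun x => q x * w.1 x) 2 (volume.restrict Ω) ≤ C * ∑ i, ‖w.2 i‖ₑ := by
  obtain ⟨v, hv, hlim⟩ := mem_closure_iff_seq_limit.mp hw.2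
  have h1 : Filter.Tendsto (fun n => (v n).1) Filter.atTop (nhds w.1) :=
    (continuous_fst.tendsto w).comp hlim
  have h2 : ∀ i, Filter.Tendsto (fun n => (v n).2 i) Filter.atTop (nhds (w.2 i)) := fun i =>
    (((continuous_apply i).comp continuous_snd).tendsto w).comp hlim
  -- Almost everywhere convergence along a subsequence is enough for Fatou's lemma; convergence of
  -- `q vₙ` in `L²` is not presupposed.
  obtain ⟨ns, hns, hae⟩ := (tendstoInMeasure_of_tendsto_Lp h1).exists_seq_tendsto_ae
  have hbound : ∀ n, eLpNorm (fun x => q x * (v n).1 x) 2 (volume.restrict Ω)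
      ≤ C * ∑ i, ‖(v n).2 i‖ₑ := by
    intro n
    obtain ⟨φ, hφ, e1, e2⟩ := hv n
    have e3 : eLpNorm (fun x => q x * (v n).1 x) 2 (volume.restrict Ω)
        = eLpNorm (fun x => q x * φ x) 2 (volume.restrict Ω) := by
      refine eLpNorm_congr_ae ?_
      filter_upwards [e1] with x hx
      rw [hx]
    rw [e3]
    refine (h φ hφ).trans_eq ?_
    congr 1
    refine Finset.sum_congr rfl fun i _ => ?_
    rw [Lp.enorm_def, eLpNorm_congr_ae (e2 i)]
  have hF : eLpNorm (fun x => q x * w.1 x) 2 (volume.restrict Ω)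
      ≤ Filter.atTop.liminf fun n =>
        eLpNorm (fun x => q x * (v (ns n)).1 x) 2 (volume.restrict Ω) := by
    refine Lp.eLpNorm_lim_le_liminf_eLpNorm
      (fun n => hq.mul (Lp.aestronglyMeasurable _)) _ ?_
    filter_upwards [hae] with x hx
    exact hx.const_mul _
  refine hF.trans ((Filter.liminf_le_liminf (Filter.Eventually.of_forall fun n =>
    hbound (ns n))).trans_eq ?_)
  refine Filter.Tendsto.liminf_eq ?_
  refine ENNReal.Tendsto.const_mul ?_ (Or.inr hC)
  exact tendsto_finsetSum _ fun i _ =>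
    ((continuous_enorm.tendsto (w.2 i)).comp (h2 i)).comp hns.tendsto_atTop

/-! ### `H₀¹(Ω)` as a Hilbert space, bounded potentials, Poincaré's inequality -/

variable {d : ℕ} {Ω : Set (Space d)}

/-- The Hilbert space `L²(Ω) × L²(Ω)^d`, which contains `H¹(Ω)` as pairs `(u, ∇u)`. -/
abbrev PairSpace {d : ℕ} (Ω : Set (Space d)) : Type := PiLp 2 (fun _ : Option (Fin d) => L2 Ω)

/-- The two components of an element of `PairSpace`. -/
noncomputable def toPair (Ω : Set (Space d)) : PairSpace Ω →L[ℂ] L2 Ω × (Fin d → L2 Ω) :=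
  (PiLp.proj (𝕜 := ℂ) 2 (fun _ : Option (Fin d) => L2 Ω) none).prod
    (ContinuousLinearMap.pi fun i => PiLp.proj (𝕜 := ℂ) 2 (fun _ : Option (Fin d) => L2 Ω) (some i))

/-- `H₀¹(Ω)` as a subspace of the Hilbert space `PairSpace`. -/
noncomputable def formDomain (Ω : Set (Space d)) : Submodule ℂ (PairSpace Ω) :=
  (sobolevH10 Ω).comap (toPair Ω).toLinearMap

/-- The embedding of `H₀¹(Ω)` into `L²(Ω)`. -/
noncomputable def embL2 (Ω : Set (Space d)) : formDomain Ω →L[ℂ] L2 Ω :=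
  PiLp.proj (𝕜 := ℂ) 2 (fun _ : Option (Fin d) => L2 Ω) none ∘L (formDomain Ω).subtypeL

/-- The `i`-th weak derivative on `H₀¹(Ω)`. -/
noncomputable def weakDeriv (Ω : Set (Space d)) (i : Fin d) : formDomain Ω →L[ℂ] L2 Ω :=
  PiLp.proj (𝕜 := ℂ) 2 (fun _ : Option (Fin d) => L2 Ω) (some i) ∘L (formDomain Ω).subtypeL

theorem pair_mem_sobolevH10 (u : formDomain Ω) :
    (embL2 Ω u, fun i => weakDeriv Ω i u) ∈ sobolevH10 Ω := u.2

theorem exists_formDomain_eq {w : L2 Ω} {g : Fin d → L2 Ω} (h : (w, g) ∈ sobolevH10 Ω) :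
    ∃ u : formDomain Ω, embL2 Ω u = w ∧ ∀ i, weakDeriv Ω i u = g i :=
  ⟨⟨WithLp.toLp 2 fun o => o.elim w g, h⟩, rfl, fun _ => rfl⟩

theorem norm_sq_formDomain (u : formDomain Ω) :
    ‖u‖ ^ 2 = ‖embL2 Ω u‖ ^ 2 + ∑ i, ‖weakDeriv Ω i u‖ ^ 2 := by
  rw [Submodule.coe_norm, PiLp.norm_sq_eq_of_L2, Fintype.sum_option]
  rfl

theorem norm_embL2_le : ‖embL2 Ω‖ ≤ 1 := by
  refine ContinuousLinearMap.opNorm_le_bound _ zero_le_one fun u => ?_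
  rw [one_mul]
  refine le_of_sq_le_sq ?_ (norm_nonneg _)
  rw [norm_sq_formDomain]
  exact le_add_of_nonneg_right (Finset.sum_nonneg fun _ _ => by positivity)

theorem continuous_integral_mul {g : Space d → ℂ} (hg : MemLp g 2 (volume.restrict Ω)) :
    Continuous fun u : L2 Ω => ∫ x in Ω, u x * g x := by
  have e : ∀ u : L2 Ω, ∫ x in Ω, u x * g x = inner ℂ (hg.star.toLp _) u := by
    intro u
    rw [L2.inner_def]
    refine integral_congr_ae ?_
    filter_upwards [hg.star.coeFn_toLp] with x hx
    rw [hx, RCLike.inner_apply]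
    simp
  simp only [e]
  fun_prop

/-- Each weak-derivative identity is a closed condition, being an equality of continuous
functionals. The resulting completeness of `H₀¹(Ω)` is what adjoints and Lax–Milgram require. -/
theorem isClosed_sobolevH1 : IsClosed (sobolevH1 Ω : Set (L2 Ω × (Fin d → L2 Ω))) := by
  have e : (sobolevH1 Ω : Set (L2 Ω × (Fin d → L2 Ω))) =
      ⋂ (φ : Space d → ℂ) (_ : IsTestFunction Ω φ) (i : Fin d),
        {w | ∫ x in Ω, w.1 x * partialDeriv i φ x = -∫ x in Ω, w.2 i x * φ x} := by
    ext w
    simp only [Set.mem_iInter]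
    rfl
  rw [e]
  refine isClosed_iInter fun φ => isClosed_iInter fun hφ => isClosed_iInter fun i => ?_
  refine isClosed_eq ?_ (Continuous.neg ?_)
  · exact (continuous_integral_mul (hφ.memLp_partialDeriv i 2 _)).comp continuous_fst
  · exact (continuous_integral_mul (hφ.memLp 2 _)).comp
      ((continuous_apply i).comp continuous_snd)

theorem isClosed_formDomain : IsClosed (formDomain Ω : Set (PairSpace Ω)) := by
  have h : IsClosed (sobolevH10 Ω : Set (L2 Ω × (Fin d → L2 Ω))) :=
    isClosed_sobolevH1.inter (Submodule.isClosed_topologicalClosure _)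
  exact h.preimage (toPair Ω).continuous

instance : CompleteSpace (formDomain Ω) := isClosed_formDomain.completeSpace_coe

/-- Multiplication by a potential with Sobolev's inequality, as a bounded operator from
`H₀¹(Ω)` to `L²(Ω)`. -/
theorem exists_potential {q : Space d → ℂ}
    (hq : AEStronglyMeasurable q (volume.restrict Ω)) {C : ℝ≥0∞} (hC : C ≠ ⊤)
    (h : ∀ w ∈ sobolevH10 Ω, eLpNorm (fun x => q x * w.1 x) 2 (volume.restrict Ω)
      ≤ C * ∑ i, ‖w.2 i‖ₑ) :
    ∃ Q : formDomain Ω →L[ℂ] L2 Ω, ∀ u, Q u =ᵐ[volume.restrict Ω] fun x => q x * embL2 Ω u x := by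
  have hbd := fun u : formDomain Ω => h _ (pair_mem_sobolevH10 u)
  have hmem : ∀ u : formDomain Ω, embL2 Ω u ∈ multiplicationDomain Ω q := fun u =>
    ⟨hq.mul (Lp.aestronglyMeasurable _), (hbd u).trans_lt (ENNReal.mul_lt_top hC.lt_top
      (ENNReal.sum_lt_top.mpr fun i _ => enorm_lt_top))⟩
  let L : formDomain Ω →ₗ[ℂ] L2 Ω :=
    (multiplication Ω q).toFun ∘ₗ (embL2 Ω).toLinearMap.codRestrict (multiplicationDomain Ω q) hmem
  have hL : ∀ u, L u =ᵐ[volume.restrict Ω] fun x => q x * embL2 Ω u x := fun u =>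
    MemLp.coeFn_toLp (mem_multiplicationDomain.mp (hmem u))
  refine ⟨L.mkContinuous (C.toReal * d) fun u => ?_, hL⟩
  have hui : ∀ i, ‖weakDeriv Ω i u‖ ≤ ‖u‖ := by
    intro i
    refine le_of_sq_le_sq ?_ (norm_nonneg _)
    rw [norm_sq_formDomain]
    exact (Finset.single_le_sum (f := fun i => ‖weakDeriv Ω i u‖ ^ 2) (fun _ _ => by positivity)
      (Finset.mem_univ i)).trans (le_add_of_nonneg_left (by positivity))
  have h1 : ‖L u‖ₑ ≤ C * ∑ i, ‖weakDeriv Ω i u‖ₑ := by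
    rw [Lp.enorm_def, eLpNorm_congr_ae (hL u)]
    exact hbd u
  have h2 : ‖L u‖ ≤ C.toReal * ∑ i, ‖weakDeriv Ω i u‖ := by
    have h3 := ENNReal.toReal_mono (ENNReal.mul_ne_top hC
      (ENNReal.sum_lt_top.mpr fun i _ => enorm_lt_top).ne) h1
    rw [ENNReal.toReal_mul, ENNReal.toReal_sum fun i _ => enorm_ne_top] at h3
    simpa using h3
  refine h2.trans ?_
  rw [mul_assoc]
  refine mul_le_mul_of_nonneg_left ?_ ENNReal.toReal_nonneg
  refine (Finset.sum_le_sum fun i _ => hui i).trans_eq ?_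
  simp

/-- Poincaré's inequality on `H₀¹(Ω)`. -/
theorem exists_poincare (hd : 2 ≤ d) (hb : Bornology.IsBounded Ω) :
    ∃ C : ℝ, 0 < C ∧ ∀ u : formDomain Ω, ‖u‖ ^ 2 ≤ C * ∑ i, ‖weakDeriv Ω i u‖ ^ 2 := by
  -- Poincaré's inequality is the Sobolev bound for the constant potential `1` and `κ = ∞`.
  have h1 : MemLp (fun _ : Space d => (1 : ℂ)) ⊤ (volume.restrict Ω) := memLp_top_const 1
  obtain ⟨C, hC, h⟩ := exists_eLpNorm_mul_test_le hd hb (ENNReal.natCast_lt_top d) h1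
  -- The factor `d` comes from Cauchy–Schwarz over the `d` derivatives; the `1` accounts for the
  -- gradient part of `‖u‖²`.
  refine ⟨C.toReal ^ 2 * d + 1, by positivity, fun u => ?_⟩
  have h2 := eLpNorm_mul_le_of_mem_sobolevH10 h1.1 hC h (pair_mem_sobolevH10 u)
  simp only [one_mul, ← Lp.enorm_def] at h2
  have h3 : ‖embL2 Ω u‖ ≤ C.toReal * ∑ i, ‖weakDeriv Ω i u‖ := by
    have h3 := ENNReal.toReal_mono (ENNReal.mul_ne_top hC
      (ENNReal.sum_lt_top.mpr fun i _ => enorm_lt_top).ne) h2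
    rw [ENNReal.toReal_mul, ENNReal.toReal_sum fun i _ => enorm_ne_top] at h3
    simpa using h3
  have h4 : (∑ i, ‖weakDeriv Ω i u‖) ^ 2 ≤ d * ∑ i, ‖weakDeriv Ω i u‖ ^ 2 := by
    simpa using sq_sum_le_card_mul_sum_sq (s := Finset.univ) (f := fun i => ‖weakDeriv Ω i u‖)
  have h5 : ‖embL2 Ω u‖ ^ 2 ≤ C.toReal ^ 2 * (d * ∑ i, ‖weakDeriv Ω i u‖ ^ 2) := by
    refine (pow_le_pow_left₀ (norm_nonneg _) h3 2).trans ?_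
    rw [mul_pow]
    gcongr
  rw [norm_sq_formDomain]
  linarith

/-! ### The form `a₀`: representing operator, weak formulation, ellipticity -/

section Form

variable {a : Fin d → Fin d → Space d → ℝ}

/-- The bounded operator on `H₀¹(Ω)` that represents the form `a₀`. -/
noncomputable def gradOperator (ha : ∀ i j, MemLp (fun x => (a i j x : ℂ)) ⊤ (volume.restrict Ω)) :
    formDomain Ω →L[ℂ] formDomain Ω :=
  ∑ i, ∑ j, (weakDeriv Ω j).adjoint ∘L mulL (volume.restrict Ω) ((ha i j).toLp _) ∘L weakDeriv Ω i

variable (ha : ∀ i j, MemLp (fun x => (a i j x : ℂ)) ⊤ (volume.restrict Ω))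

theorem integrable_formIntegrand
    (ha : ∀ i j, MemLp (fun x => (a i j x : ℂ)) ⊤ (volume.restrict Ω)) (g h : Fin d → L2 Ω) (i j : Fin d) :
    Integrable (formIntegrand a g h i j) (volume.restrict Ω) :=
  integrable_mul_conj (h j) _ (coeFn_mulL (ha i j) (g i))

theorem inner_gradOperator (u v : formDomain Ω) :
    inner ℂ v (gradOperator ha u) = form a (fun i => weakDeriv Ω i u) (fun i => weakDeriv Ω i v) := by
  simp only [gradOperator, form, FunLike.coe_sum, Finset.sum_apply, inner_sum,
    ContinuousLinearMap.comp_apply, ContinuousLinearMap.adjoint_inner_right]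
  exact Finset.sum_congr rfl fun i _ => Finset.sum_congr rfl fun j _ =>
    inner_eq_integral _ _ (coeFn_mulL (ha i j) _)

/-- Testing with every `v` in a Hilbert space determines a vector, so the weak formulation is a
single equation in `H₀¹(Ω)`. This turns statements about the unbounded `A₀` into statements about
bounded operators. -/
theorem mem_dirichletGraph_iff {w f : L2 Ω} :
    (w, f) ∈ dirichletGraph Ω a ↔
      ∃ u, embL2 Ω u = w ∧ gradOperator ha u = (embL2 Ω).adjoint f := by
  constructor
  · rintro ⟨g, hg, H⟩
    obtain ⟨u, hu, hug⟩ := exists_formDomain_eq hg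
    obtain rfl : (fun i => weakDeriv Ω i u) = g := funext hug
    refine ⟨u, hu, ext_inner_left ℂ fun v => ?_⟩
    rw [inner_gradOperator, ContinuousLinearMap.adjoint_inner_right]
    exact (H _ _ (pair_mem_sobolevH10 v)).2
  · rintro ⟨u, rfl, hu⟩
    refine ⟨_, pair_mem_sobolevH10 u, fun v h hv => ⟨integrable_formIntegrand ha _ h, ?_⟩⟩
    obtain ⟨v, rfl, hvh⟩ := exists_formDomain_eq hv
    obtain rfl : (fun i => weakDeriv Ω i v) = h := funext hvh
    rw [← inner_gradOperator ha, hu, ContinuousLinearMap.adjoint_inner_right]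

/-- Passage from real to complex vectors: for `z = ξ + iη` the real part of the sum is the quadratic
form at `ξ` plus that at `η`, and symmetry makes the sum equal to its conjugate. -/
theorem re_im_quadratic {A : Fin d → Fin d → ℝ} (hA : ∀ i j, A i j = A j i) {c : ℝ}
    (hc : ∀ ξ : Space d, c * ‖ξ‖ ^ 2 ≤ ∑ i, ∑ j, A i j * ξ i * ξ j) (z : Fin d → ℂ) :
    c * ∑ i, ‖z i‖ ^ 2 ≤ (∑ i, ∑ j, (A i j : ℂ) * z i * (starRingEnd ℂ) (z j)).re ∧
      (∑ i, ∑ j, (A i j : ℂ) * z i * (starRingEnd ℂ) (z j)).im = 0 := by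
  constructor
  · have h1 := hc (WithLp.toLp 2 fun i => (z i).re)
    have h2 := hc (WithLp.toLp 2 fun i => (z i).im)
    simp only [EuclideanSpace.norm_sq_eq, Real.norm_eq_abs, sq_abs] at h1 h2
    have e : (∑ i, ∑ j, (A i j : ℂ) * z i * (starRingEnd ℂ) (z j)).re =
        ∑ i, ∑ j, A i j * (z i).re * (z j).re + ∑ i, ∑ j, A i j * (z i).im * (z j).im := by
      simp only [Complex.re_sum, ← Finset.sum_add_distrib]
      refine Finset.sum_congr rfl fun i _ => Finset.sum_congr rfl fun j _ => ?_
      simp [Complex.mul_re]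
    have e2 : ∑ i, ‖z i‖ ^ 2 = ∑ i, (z i).re ^ 2 + ∑ i, (z i).im ^ 2 := by
      rw [← Finset.sum_add_distrib]
      refine Finset.sum_congr rfl fun i _ => ?_
      rw [← Complex.normSq_eq_norm_sq, Complex.normSq_apply]
      ring
    rw [e, e2, mul_add]
    exact add_le_add h1 h2
  · rw [← Complex.conj_eq_iff_im]
    simp only [map_sum, map_mul, Complex.conj_ofReal, Complex.conj_conj]
    rw [Finset.sum_comm]
    refine Finset.sum_congr rfl fun i _ => Finset.sum_congr rfl fun j _ => ?_
    rw [hA j i]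
    ring

theorem re_im_inner_gradOperator
    (hsymm : ∀ i j, ∀ᵐ x ∂(volume.restrict Ω), a i j x = a j i x) {c : ℝ}
    (hc : ∀ᵐ x ∂(volume.restrict Ω), ∀ ξ : Space d,
      c * ‖ξ‖ ^ 2 ≤ ∑ i, ∑ j, a i j x * ξ i * ξ j) (u : formDomain Ω) :
    c * ∑ i, ‖weakDeriv Ω i u‖ ^ 2 ≤ (inner ℂ u (gradOperator ha u)).re ∧
      (inner ℂ u (gradOperator ha u)).im = 0 := by
  set g : Fin d → L2 Ω := fun i => weakDeriv Ω i u
  have hint := integrable_formIntegrand ha g g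
  have hint1 : ∀ i, Integrable (fun x => ∑ j, formIntegrand a g g i j x) (volume.restrict Ω) :=
    fun i => integrable_finsetSum _ fun j _ => hint i j
  have hint2 : Integrable (fun x => ∑ i, ∑ j, formIntegrand a g g i j x) (volume.restrict Ω) :=
    integrable_finsetSum _ fun i _ => hint1 i
  have e : inner ℂ u (gradOperator ha u) = ∫ x in Ω, ∑ i, ∑ j, formIntegrand a g g i j x := by
    rw [inner_gradOperator, form, integral_finsetSum _ fun i _ => hint1 i]
    exact Finset.sum_congr rfl fun i _ => (integral_finsetSum _ fun j _ => hint i j).symm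
  have hs : ∀ᵐ x ∂(volume.restrict Ω), ∀ i j, a i j x = a j i x :=
    ae_all_iff.mpr fun i => ae_all_iff.mpr fun j => hsymm i j
  have key : ∀ᵐ x ∂(volume.restrict Ω), c * ∑ i, ‖g i x‖ ^ 2
      ≤ (∑ i, ∑ j, formIntegrand a g g i j x).re ∧
        (∑ i, ∑ j, formIntegrand a g g i j x).im = 0 := by
    filter_upwards [hs, hc] with x h1 h2
    exact re_im_quadratic h1 h2 fun i => g i x
  rw [e]
  constructor
  · have e1 : (∫ x in Ω, ∑ i, ∑ j, formIntegrand a g g i j x).re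
        = ∫ x in Ω, (∑ i, ∑ j, formIntegrand a g g i j x).re := (integral_re hint2).symm
    have e2 : c * ∑ i, ‖g i‖ ^ 2 = ∫ x in Ω, c * ∑ i, ‖g i x‖ ^ 2 := by
      rw [integral_const_mul, integral_finsetSum _ fun i _ => integrable_norm_sq (g i)]
      simp only [norm_sq_eq_integral]
    rw [e1, e2]
    exact integral_mono_ae ((integrable_finsetSum _ fun i _ =>
      integrable_norm_sq (g i)).const_mul c) hint2.re (key.mono fun x hx => hx.1)
  · have e1 : (∫ x in Ω, ∑ i, ∑ j, formIntegrand a g g i j x).im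
        = ∫ x in Ω, (∑ i, ∑ j, formIntegrand a g g i j x).im := (integral_im hint2).symm
    rw [e1]
    exact integral_eq_zero_of_ae (key.mono fun x hx => hx.2)

end Form

/-! ### From the form to the unbounded operator `A_q + m` -/

section Operator

variable {d : ℕ} {Ω : Set (Space d)} {a : Fin d → Fin d → Space d → ℝ} {q : Space d → ℝ}

theorem re_im_inner_potential {Q : formDomain Ω →L[ℂ] L2 Ω}
    (hQ : ∀ u, Q u =ᵐ[volume.restrict Ω] fun x => (q x : ℂ) * embL2 Ω u x)
    (hq : ∀ᵐ x ∂(volume.restrict Ω), 0 ≤ q x) (u : formDomain Ω) :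
    0 ≤ (inner ℂ (embL2 Ω u) (Q u)).re ∧ (inner ℂ (embL2 Ω u) (Q u)).im = 0 := by
  -- The factors `1`, `i`, `-i` with lower bound `0` give `Re ≥ 0`, `Im ≤ 0` and `Im ≥ 0`.
  have h1 := le_re_inner_mul (hQ u) 1 0 (hq.mono fun x hx => by simpa using hx)
  have h2 := le_re_inner_mul (hQ u) Complex.I 0 (Filter.Eventually.of_forall fun x => by simp)
  have h3 := le_re_inner_mul (hQ u) (-Complex.I) 0 (Filter.Eventually.of_forall fun x => by simp)
  simp only [zero_mul, one_mul, Complex.neg_re, neg_mul, Complex.I_mul_re] at h1 h2 h3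
  exact ⟨h1, by linarith⟩

/-- An element of the domain of `A₀` lies in `H₀¹(Ω)`, where `Q` already realises multiplication by
`q` with values in `L²`. -/
theorem dirichletOperator_domain_le (hΩ : IsOpen Ω)
    (ha : ∀ i j, MemLp (fun x => (a i j x : ℂ)) ⊤ (volume.restrict Ω))
    {Q : formDomain Ω →L[ℂ] L2 Ω}
    (hQ : ∀ u, Q u =ᵐ[volume.restrict Ω] fun x => (q x : ℂ) * embL2 Ω u x) :
    (dirichletOperator Ω a).domain ≤ multiplicationDomain Ω fun x => (q x : ℂ) := by
  intro w hw
  have h := (dirichletOperator Ω a).mem_graph ⟨w, hw⟩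
  rw [dirichletOperator_graph hΩ, mem_dirichletGraph_iff ha] at h
  obtain ⟨u, hu, -⟩ := h
  obtain rfl : embL2 Ω u = w := hu
  exact (Lp.memLp (Q u)).ae_eq (hQ u)

theorem multiplication_apply_eq {m : Space d → ℂ} {w v : L2 Ω} (hw : w ∈ multiplicationDomain Ω m)
    (hv : v =ᵐ[volume.restrict Ω] fun x => m x * w x) : multiplication Ω m ⟨w, hw⟩ = v :=
  Lp.ext ((MemLp.coeFn_toLp (mem_multiplicationDomain.mp hw)).trans hv.symm)

/-- The inverse of `A_q + m` obtained from the form. -/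
theorem isBoundedInverse_formResolvent (hΩ : IsOpen Ω)
    (ha : ∀ i j, MemLp (fun x => (a i j x : ℂ)) ⊤ (volume.restrict Ω))
    {Q : formDomain Ω →L[ℂ] L2 Ω}
    (hQ : ∀ u, Q u =ᵐ[volume.restrict Ω] fun x => (q x : ℂ) * embL2 Ω u x)
    {m : Space d → ℂ} (hm : MemLp m ⊤ (volume.restrict Ω))
    (hU : IsUnit (formOperator (embL2 Ω) (gradOperator ha + (embL2 Ω).adjoint ∘L Q)
      (mulL _ (hm.toLp m)))) :
    IsBoundedInverse (schrodingerOperator Ω a q + multiplication Ω m)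
      (formResolvent (embL2 Ω) (gradOperator ha + (embL2 Ω).adjoint ∘L Q)
        (mulL _ (hm.toLp m))) := by
  constructor
  · intro f
    obtain ⟨u, hu, h1⟩ := exists_formResolvent_eq hU f
    -- The value of `A₀` at the solution is what remains of `f` after the two multiplication terms
    -- are removed.
    have h2 : (embL2 Ω u, f - (Q u + mulL _ (hm.toLp m) (embL2 Ω u)))
        ∈ (dirichletOperator Ω a).graph := by
      rw [dirichletOperator_graph hΩ, mem_dirichletGraph_iff ha]
      exact ⟨u, rfl, h1⟩
    rw [hu]
    obtain ⟨⟨w, hw⟩, rfl, h3⟩ := (LinearPMap.mem_graph_iff _).mp h2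
    have h4 : embL2 Ω u ∈ multiplicationDomain Ω fun x => (q x : ℂ) :=
      dirichletOperator_domain_le hΩ ha hQ hw
    have h5 : embL2 Ω u ∈ multiplicationDomain Ω m := memLp_mul hm _
    refine ⟨⟨⟨hw, h4⟩, h5⟩, ?_⟩
    change dirichletOperator Ω a ⟨embL2 Ω u, hw⟩
      + multiplication Ω (fun x => (q x : ℂ)) ⟨embL2 Ω u, h4⟩
      + multiplication Ω m ⟨embL2 Ω u, h5⟩ = f
    rw [multiplication_apply_eq h4 (hQ u), multiplication_apply_eq h5 (coeFn_mulL hm _), h3,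
      add_assoc]
    exact sub_add_cancel _ _
  · rintro ⟨w, ⟨hw, h4⟩, h5⟩
    have h2 := (dirichletOperator Ω a).mem_graph ⟨w, hw⟩
    rw [dirichletOperator_graph hΩ, mem_dirichletGraph_iff ha] at h2
    obtain ⟨u, rfl, h3⟩ := h2
    change formResolvent _ _ _ (dirichletOperator Ω a ⟨embL2 Ω u, hw⟩
      + multiplication Ω (fun x => (q x : ℂ)) ⟨embL2 Ω u, h4⟩
      + multiplication Ω m ⟨embL2 Ω u, h5⟩) = embL2 Ω u
    rw [multiplication_apply_eq h4 (hQ u), multiplication_apply_eq h5 (coeFn_mulL hm _)]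
    exact formResolvent_add_comp_apply hU h3

/-- Inversion in the Banach algebra of bounded operators on `V` is differentiable at units, and the
other factors are constant or linear in `M`. -/
theorem differentiableAt_formResolvent {V H : Type*} [NormedAddCommGroup V]
    [InnerProductSpace ℂ V] [CompleteSpace V] [NormedAddCommGroup H] [InnerProductSpace ℂ H]
    [CompleteSpace H] {J : V →L[ℂ] H} {S : V →L[ℂ] V} {M : ℂ → H →L[ℂ] H} {p : ℂ}
    (hM : DifferentiableAt ℂ M p) (hU : IsUnit (formOperator J S (M p))) :
    DifferentiableAt ℂ (fun p => formResolvent J S (M p)) p := by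
  have h1 : DifferentiableAt ℂ (fun p => formOperator J S (M p)) p :=
    (differentiableAt_const _).add
      ((differentiableAt_const _).clm_comp (hM.clm_comp (differentiableAt_const _)))
  have h2 : DifferentiableAt ℂ (fun p => Ring.inverse (formOperator J S (M p))) p :=
    DifferentiableAt.comp p (g := Ring.inverse) (differentiableAt_inverse hU) h1
  exact (differentiableAt_const _).clm_comp (h2.clm_comp (differentiableAt_const _))

end Operator

/-! ### Trigonometric estimates for the rotated symbol -/

section Symbol

/-- Polar form: the rotation shifts the phase `α Im z` by `-φ` and leaves the amplitude `ρ e^{α Re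
z}` alone. -/
theorem re_rotation_mul_symbol (φ ρ α : ℝ) (z : ℂ) :
    (Complex.exp (-(φ * Complex.I)) * (ρ * Complex.exp (z * α))).re
      = ρ * Real.exp (z.re * α) * Real.cos (α * z.im - φ) := by
  rw [mul_left_comm, ← Complex.exp_add, Complex.re_ofReal_mul, Complex.exp_re]
  simp only [Complex.add_re, Complex.add_im, Complex.neg_re, Complex.neg_im, Complex.mul_re,
    Complex.mul_im, Complex.ofReal_re, Complex.ofReal_im, Complex.I_re, Complex.I_im]
  rw [mul_assoc]
  congr 3 <;> ring_nf

theorem norm_rotation (φ : ℝ) : ‖Complex.exp (-(φ * Complex.I))‖ = 1 := by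
  have := Complex.norm_exp_ofReal_mul_I (-φ)
  simpa using this

theorem re_rotation (φ : ℝ) : (Complex.exp (-(φ * Complex.I))).re = Real.cos φ := by
  have := Complex.exp_ofReal_mul_I_re (-φ)
  simpa using this

/-- The function `t ↦ r^{-t}` is monotone, so on `[α₀, α_M]` it is largest at an endpoint: `α₀` for
`r ≥ 1`, `α_M` for `r ≤ 1`. -/
theorem inv_max_rpow_le {r α α₀ αM : ℝ} (hr : 0 < r) (h0 : α₀ ≤ α) (hM : α ≤ αM) :
    (max (r ^ (-α₀)) (r ^ (-αM)))⁻¹ ≤ r ^ α := by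
  rw [inv_le_comm₀ (lt_max_of_lt_left (Real.rpow_pos_of_pos hr _)) (Real.rpow_pos_of_pos hr _),
    ← Real.rpow_neg hr.le]
  rcases le_total 1 r with h | h
  · exact (Real.rpow_le_rpow_of_exponent_le h (by linarith)).trans (le_max_left _ _)
  · exact (Real.rpow_le_rpow_of_exponent_ge hr h (by linarith)).trans (le_max_right _ _)

/-- One of the powers `r^{±(α_M - α₀)}` is at most `1`, and so is `ρ₀ / (3 ρ_M)`; hence `α_M θ_*(r)
≤ arctan 1 = π/4`. Only this crude consequence of the definition of `θ_*` is needed, since `|αβ| ≤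
π/3` suffices. -/
theorem half_le_cos_of_le_thetaStar {α₀ αM ρ₀ ρM r β α : ℝ} (hα₀ : 0 < α₀) (h0 : α₀ ≤ α)
    (hM : α ≤ αM) (hρ₀ : 0 < ρ₀) (hρ : ρ₀ ≤ ρM) (hr : 0 < r)
    (h : |β| ≤ thetaStar α₀ αM ρ₀ ρM r) : 1 / 2 ≤ Real.cos (α * β) := by
  have hαM : 0 < αM := by linarith
  have hρM : 0 < ρM := by linarith
  have hq0 : 0 ≤ ρ₀ / (3 * ρM) := by positivity
  have hq1 : ρ₀ / (3 * ρM) ≤ 1 := by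
    rw [div_le_one (by positivity)]
    linarith
  have key : ∀ t : ℝ, t ≤ 1 → 0 ≤ t → Real.arctan (ρ₀ / (3 * ρM) * t) ≤ Real.pi / 4 := by
    intro t ht ht0
    rw [← Real.arctan_one]
    exact Real.arctan_strictMono.monotone (mul_le_one₀ hq1 ht0 ht)
  have h1 : αM * |β| ≤ Real.pi / 4 := by
    have h2 : αM * |β| ≤ min (Real.arctan (ρ₀ / (3 * ρM) * r ^ (αM - α₀)))
        (Real.arctan (ρ₀ / (3 * ρM) * r ^ (-(αM - α₀)))) := by
      rwa [thetaStar, ← div_eq_inv_mul, le_div_iff₀ hαM, mul_comm] at h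
    refine h2.trans ?_
    rcases le_total 1 r with h | h
    · exact (min_le_right _ _).trans
        (key _ (Real.rpow_le_one_of_one_le_of_nonpos h (by linarith))
          (Real.rpow_nonneg hr.le _))
    · exact (min_le_left _ _).trans
        (key _ (Real.rpow_le_one hr.le h (by linarith))
          (Real.rpow_nonneg hr.le _))
  have h3 : |α * β| ≤ Real.pi / 3 := by
    rw [abs_mul, abs_of_pos (hα₀.trans_le h0)]
    have := mul_le_mul_of_nonneg_right hM (abs_nonneg β)
    linarith [Real.pi_pos]
  rw [← Real.cos_pi_div_three, ← Real.cos_abs (α * β)]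
  exact Real.cos_le_cos_of_nonneg_of_le_pi (abs_nonneg _) (by linarith [Real.pi_pos]) h3

theorem sin_mul_abs_pos {α β : ℝ} (h0 : 0 < α) (h1 : α < 1) (hβ0 : β ≠ 0) (hβ : |β| < Real.pi) :
    0 < Real.sin (α * |β|) := by
  have hb : 0 < |β| := abs_pos.mpr hβ0
  exact Real.sin_pos_of_pos_of_lt_pi (by positivity) (by nlinarith)

theorem abs_sin_mul {α β : ℝ} (h0 : 0 < α) (h1 : α < 1) (hβ0 : β ≠ 0) (hβ : |β| < Real.pi) :
    |Real.sin (α * β)| = Real.sin (α * |β|) := by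
  rw [← abs_of_pos (sin_mul_abs_pos h0 h1 hβ0 hβ)]
  rcases abs_choice β with h | h <;> rw [h]
  simp

theorem cStar_pos {α₀ αM β : ℝ} (hα₀ : 0 < α₀) (hα₁ : α₀ < 1) (hβ0 : β ≠ 0)
    (hβ : |β| < Real.pi) : 0 < cStar α₀ αM β := by
  refine lt_max_of_lt_left (inv_pos.mpr ?_)
  rw [abs_sin_mul hα₀ hα₁ hβ0 hβ]
  exact sin_mul_abs_pos hα₀ hα₁ hβ0 hβ

/-- The sine is concave on `[0, π]`, so on the interval from `α₀|β|` to `α_M|β|` it is at least the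
smaller of its endpoint values, which is `1 / c_*(β)`. -/
theorem inv_cStar_le_sin {α₀ αM β α : ℝ} (hα₀ : 0 < α₀) (h0 : α₀ ≤ α) (hM : α ≤ αM)
    (hαM : αM < 1) (hβ0 : β ≠ 0) (hβ : |β| < Real.pi) :
    (cStar α₀ αM β)⁻¹ ≤ Real.sin (α * |β|) := by
  have hM0 : 0 < αM := by linarith
  have hm1 : α₀ < 1 := by linarith
  have hb : 0 < |β| := abs_pos.mpr hβ0
  have hcpos := cStar_pos (αM := αM) hα₀ hm1 hβ0 hβ
  have p0 := sin_mul_abs_pos hα₀ hm1 hβ0 hβ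
  have pM := sin_mul_abs_pos hM0 hαM hβ0 hβ
  have hmin : min (Real.sin (α₀ * |β|)) (Real.sin (αM * |β|)) ≤ Real.sin (α * |β|) :=
    strictConcaveOn_sin_Icc.concaveOn.min_le_of_mem_Icc
      ⟨by positivity, by nlinarith⟩ ⟨by positivity, by nlinarith⟩
      ⟨by gcongr, by gcongr⟩
  refine le_trans (le_min ?_ ?_) hmin
  · rw [inv_le_comm₀ hcpos p0, ← abs_sin_mul hα₀ hm1 hβ0 hβ]
    exact le_max_left _ _
  · rw [inv_le_comm₀ hcpos pM, ← abs_sin_mul hM0 hαM hβ0 hβ]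
    exact le_max_right _ _

/-- The angle `β α_M / 2` is the midpoint between `0` and `α_M β`, so `αβ` differs from it by at
most `|β| α_M / 2 < π/2`. -/
theorem cos_rotation_nonneg {α αM β : ℝ} (h0 : 0 < α) (hM : α ≤ αM) (hαM : αM < 1)
    (hβ : |β| < Real.pi) : 0 ≤ Real.cos (α * β - β * αM / 2) := by
  have h : |α * β - β * αM / 2| ≤ Real.pi / 2 := by
    rw [show α * β - β * αM / 2 = β * (α - αM / 2) by ring, abs_mul]
    have h1 : |α - αM / 2| ≤ 1 / 2 := abs_le.mpr ⟨by linarith, by linarith⟩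
    have := mul_le_mul hβ.le h1 (abs_nonneg _) Real.pi_pos.le
    linarith
  exact Real.cos_nonneg_of_neg_pi_div_two_le_of_le (abs_le.mp h).1 (abs_le.mp h).2

/-- Makes the coercivity left after the midpoint rotation uniform in `β`. -/
theorem cos_half_le {αM β : ℝ} (h0 : 0 < αM) (hαM : αM < 1) (hβ : |β| < Real.pi) :
    Real.cos (Real.pi * αM / 2) ≤ Real.cos (β * αM / 2) := by
  have h : |β * αM / 2| ≤ Real.pi * αM / 2 := by
    rw [abs_div, abs_mul, abs_of_pos h0, abs_two]
    gcongr
  rw [← Real.cos_abs (β * αM / 2)]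
  exact Real.cos_le_cos_of_nonneg_of_le_pi (abs_nonneg _) (by nlinarith [Real.pi_pos]) h

theorem cos_half_pos {αM : ℝ} (h0 : 0 < αM) (hαM : αM < 1) :
    0 < Real.cos (Real.pi * αM / 2) :=
  Real.cos_pos_of_mem_Ioo ⟨by nlinarith [Real.pi_pos], by nlinarith [Real.pi_pos]⟩

end Symbol

/-! ### Resolvent bounds and holomorphy for the symbol `ρ e^{zα}` -/

section ResolventBounds

variable {X V : Type*} [MeasurableSpace X] {μ : Measure X} [NormedAddCommGroup V]
  [InnerProductSpace ℂ V] [CompleteSpace V] {J : V →L[ℂ] Lp ℂ 2 μ} {S : V →L[ℂ] V} {c : ℝ}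
  {α ρ : X → ℝ} {α₀ αM ρ₀ ρM : ℝ}

/-- Lower bound of the numerical range of the rotated multiplication operator. -/
theorem le_re_rotation_inner_expSymbol (hα : MemLp α ∞ μ) (hρ : MemLp ρ ∞ μ) (φ b : ℝ) (z : ℂ)
    (h : ∀ᵐ x ∂μ, b ≤ ρ x * Real.exp (z.re * α x) * Real.cos (α x * z.im - φ)) (w : Lp ℂ 2 μ) :
    b * ‖w‖ ^ 2 ≤ (Complex.exp (-(φ * Complex.I))
      * inner ℂ w (mulL μ (expSymbol hα hρ z) w)).re :=
  le_re_inner_mul (coeFn_mulL (memLp_mul_exp hα hρ z) w) _ b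
    (h.mono fun x hx => by rwa [re_rotation_mul_symbol])

/-- Rotation by the midpoint angle `Im z · α_M / 2` keeps the form coercive and the symbol
nonnegative. The resulting constant does not depend on `z` in the strip `|Im z| < π`. -/
theorem isUnit_and_norm_formResolvent_le (hα : MemLp α ∞ μ) (hρ : MemLp ρ ∞ μ) (hα₀ : 0 < α₀)
    (hα_le : α₀ ≤ αM) (hαM : αM < 1) (hρ₀ : 0 < ρ₀) (hα_bound : ∀ᵐ x ∂μ, α₀ ≤ α x ∧ α x ≤ αM)
    (hρ_bound : ∀ᵐ x ∂μ, ρ₀ ≤ ρ x ∧ ρ x ≤ ρM) (hJ : ‖J‖ ≤ 1)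
    (hS : ∀ u, (inner ℂ u (S u)).im = 0) (hc0 : 0 < c)
    (hc : ∀ u, c * ‖u‖ ^ 2 ≤ (inner ℂ u (S u)).re) {z : ℂ} (hz : |z.im| < Real.pi) :
    IsUnit (formOperator J S (mulL μ (expSymbol hα hρ z))) ∧
      ‖formResolvent J S (mulL μ (expSymbol hα hρ z))‖
        ≤ 1 / (Real.cos (Real.pi * αM / 2) * c) := by
  have hM0 : 0 < αM := by linarith
  have hl := cos_half_le hM0 hαM hz
  have hl0 := cos_half_pos hM0 hαM
  have hre : 0 < (Complex.exp (-((z.im * αM / 2 : ℝ) * Complex.I))).re := by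
    rw [re_rotation]
    linarith
  have hM : ∀ w, 0 ≤ (Complex.exp (-((z.im * αM / 2 : ℝ) * Complex.I))
      * inner ℂ w (mulL μ (expSymbol hα hρ z) w)).re := by
    intro w
    have := le_re_rotation_inner_expSymbol hα hρ (z.im * αM / 2) 0 z (by
      filter_upwards [hα_bound, hρ_bound] with x h1 h2
      have := cos_rotation_nonneg (hα₀.trans_le h1.1) h1.2 hαM hz
      have : 0 ≤ ρ x := hρ₀.le.trans h2.1
      positivity) w
    simpa using this
  have hU : IsUnit (formOperator J S (mulL μ (expSymbol hα hρ z))) :=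
    isUnit_formOperator hS hc0 hc hre hM
  refine ⟨hU, (norm_formResolvent_le_of_coercive hJ hU hS hc0 hc hre hM).trans ?_⟩
  rw [norm_rotation, re_rotation]
  gcongr

/-- Here the bound comes from the symbol, not from coercivity: its modulus is at least `ρ₀ / max
r^{-α_j}`, and a rotation by `0` or `±π/2` makes its real part a definite fraction of that.
Invertibility is an assumption, because the form gives no control when `cos φ = 0`. -/
theorem norm_formResolvent_le_resolventConst (hα : MemLp α ∞ μ) (hρ : MemLp ρ ∞ μ) (hα₀ : 0 < α₀)
    (hα_le : α₀ ≤ αM) (hαM : αM < 1) (hρ₀ : 0 < ρ₀) (hρ_le : ρ₀ ≤ ρM)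
    (hα_bound : ∀ᵐ x ∂μ, α₀ ≤ α x ∧ α x ≤ αM)
    (hρ_bound : ∀ᵐ x ∂μ, ρ₀ ≤ ρ x ∧ ρ x ≤ ρM)
    (hS : ∀ u, (inner ℂ u (S u)).im = 0) (hc0 : 0 < c)
    (hc : ∀ u, c * ‖u‖ ^ 2 ≤ (inner ℂ u (S u)).re) {z : ℂ} (hz : |z.im| < Real.pi)
    (hU : IsUnit (formOperator J S (mulL μ (expSymbol hα hρ z)))) {r : ℝ} (hr : 0 < r)
    (hzr : z.re = Real.log r) :
    ‖formResolvent J S (mulL μ (expSymbol hα hρ z))‖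
      ≤ resolventConst α₀ αM ρ₀ ρM r z.im * max (r ^ (-α₀)) (r ^ (-αM)) := by
  set m := max (r ^ (-α₀)) (r ^ (-αM)) with hm
  have hm0 : 0 < m := lt_max_of_lt_left (Real.rpow_pos_of_pos hr _)
  have hlow : ∀ᵐ x ∂μ, ρ₀ * m⁻¹ ≤ ρ x * Real.exp (z.re * α x) := by
    filter_upwards [hα_bound, hρ_bound] with x h1 h2
    rw [hzr, ← Real.rpow_def_of_pos hr]
    exact mul_le_mul h2.1 (inv_max_rpow_le hr h1.1 h1.2) (by positivity) (hρ₀.le.trans h2.1)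
  -- Both cases at once: `φ` is the rotation and `1/s` the lower bound of the rotated cosine, so `s`
  -- is `2` or `c_*`.
  have key : ∀ φ s : ℝ, 0 ≤ Real.cos φ → 0 < s →
      (∀ᵐ x ∂μ, s⁻¹ ≤ Real.cos (α x * z.im - φ)) →
      ‖formResolvent J S (mulL μ (expSymbol hα hρ z))‖ ≤ ρ₀⁻¹ * s * m := by
    intro φ s hφ hs h
    have hb : 0 < ρ₀ * m⁻¹ * s⁻¹ := by positivity
    refine (norm_formResolvent_le_div hU hS hc0.le hc (by rwa [re_rotation]) hb
      (le_re_rotation_inner_expSymbol hα hρ φ _ z ?_)).trans_eq ?_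
    · filter_upwards [hlow, h] with x h1 h2
      exact mul_le_mul h1 h2 (by positivity) (le_trans (by positivity) h1)
    · rw [norm_rotation]
      field_simp
  unfold resolventConst
  split_ifs with hβ
  · rw [mul_comm 2]
    refine key 0 2 (by simp) two_pos ?_
    filter_upwards [hα_bound] with x h1
    rw [sub_zero, ← one_div]
    exact half_le_cos_of_le_thetaStar hα₀ h1.1 h1.2 hρ₀ hρ_le hr hβ
  -- Since `θ_* ≥ 0`, the angle zero belongs to the first case; so the sines in `c_*` do not vanish
  -- here.
  · have hβ0 : z.im ≠ 0 := by
      intro h0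
      refine hβ ?_
      rw [h0, abs_zero, thetaStar]
      have h1 : 0 ≤ ρ₀ / (3 * ρM) := by
        have : 0 < ρM := by linarith
        positivity
      have hM0 : 0 < αM := by linarith
      exact mul_nonneg (by positivity) (le_min (Real.arctan_nonneg.mpr (by positivity))
        (Real.arctan_nonneg.mpr (by positivity)))
    have hs := cStar_pos (αM := αM) hα₀ (hα_le.trans_lt hαM) hβ0 hz
    -- The rotation `±π/2` takes the sign of `β`, which turns the cosine into `sin(α|β|)`.
    rcases lt_or_gt_of_ne hβ0 with h0 | h0
    · refine key (-(Real.pi / 2)) _ (by simp) hs ?_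
      filter_upwards [hα_bound] with x h1
      have h2 := inv_cStar_le_sin hα₀ h1.1 h1.2 hαM hβ0 hz
      rwa [abs_of_neg h0, mul_neg, Real.sin_neg, ← Real.cos_add_pi_div_two,
        ← sub_neg_eq_add] at h2
    · refine key (Real.pi / 2) _ (by simp) hs ?_
      filter_upwards [hα_bound] with x h1
      have h2 := inv_cStar_le_sin hα₀ h1.1 h1.2 hαM hβ0 hz
      rwa [abs_of_pos h0, ← Real.cos_sub_pi_div_two] at h2

theorem differentiableAt_formResolvent_log (hα : MemLp α ∞ μ) (hρ : MemLp ρ ∞ μ)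
    (hα1 : ∀ᵐ x ∂μ, |α x| ≤ 1) (hρM : ∀ᵐ x ∂μ, |ρ x| ≤ ρM) {p : ℂ} (hp : p ∈ Complex.slitPlane)
    (hU : IsUnit (formOperator J S (mulL μ (expSymbol hα hρ (Complex.log p))))) :
    DifferentiableAt ℂ
      (fun p => formResolvent J S (mulL μ (expSymbol hα hρ (Complex.log p)))) p := by
  refine differentiableAt_formResolvent (M := fun p => mulL μ (expSymbol hα hρ (Complex.log p)))
    ?_ hU
  have h : DifferentiableAt ℂ (fun p => expSymbol hα hρ (Complex.log p)) p :=
    (differentiable_expSymbol hα hρ hα1 hρM _).comp p (Complex.differentiableAt_log hp)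
  exact (mulL μ).differentiableAt.comp p h

end ResolventBounds

end VariableOrder

/-! ### The theorem -/

set_option maxHeartbeats 400000 in
open VariableOrder in
theorem proposition2p1
    (d : ℕ) (hd : 2 ≤ d)
    (Ω : Set (VariableOrder.Space d)) (hΩopen : IsOpen Ω) (hΩconn : IsConnected Ω)
    (hΩbdd : Bornology.IsBounded Ω)
    (a : Fin d → Fin d → VariableOrder.Space d → ℝ)
    (ha : ∀ i j, MemLp (a i j) ∞ (volume.restrict Ω))
    (hsymm : ∀ i j, ∀ᵐ x ∂(volume.restrict Ω), a i j x = a j i x)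
    (hell : ∃ c : ℝ, 0 < c ∧ ∀ᵐ x ∂(volume.restrict Ω), ∀ ξ : VariableOrder.Space d,
      c * ‖ξ‖ ^ 2 ≤ ∑ i, ∑ j, a i j x * ξ i * ξ j)
    (κ : ℝ≥0∞) (hκ : (d : ℝ≥0∞) < κ)
    (q : VariableOrder.Space d → ℝ) (hq : MemLp q κ (volume.restrict Ω))
    (hq_nonneg : ∀ᵐ x ∂(volume.restrict Ω), 0 ≤ q x)
    (α ρ : VariableOrder.Space d → ℝ)
    (hα : MemLp α ∞ (volume.restrict Ω)) (hρ : MemLp ρ ∞ (volume.restrict Ω))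
    (α₀ αM ρ₀ ρM : ℝ) (hα₀ : 0 < α₀) (hαM : αM < 1) (hρ₀ : 0 < ρ₀)
    (hα_bound : ∀ᵐ x ∂(volume.restrict Ω), α₀ ≤ α x ∧ α x ≤ αM)
    (hρ_bound : ∀ᵐ x ∂(volume.restrict Ω), ρ₀ ≤ ρ x ∧ ρ x ≤ ρM) :
    (VariableOrder.schrodingerOperator Ω a q).domain
        = (VariableOrder.dirichletOperator Ω a).domain ∧
    ∃ R : ℂ → (VariableOrder.L2 Ω →L[ℂ] VariableOrder.L2 Ω),
      (∀ p ∈ Complex.slitPlane,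
        VariableOrder.IsBoundedInverse (VariableOrder.pencil Ω a q ρ α p) (R p) ∧
        ∀ f, R p f ∈ (VariableOrder.dirichletOperator Ω a).domain) ∧
      (∀ r : ℝ, 0 < r → ∀ β : ℝ, -Real.pi < β → β < Real.pi →
        VariableOrder.IsBoundedInverse (VariableOrder.polarPencil Ω a q ρ α r β)
          (R ((r : ℂ) * Complex.exp (Complex.I * (β : ℂ)))) ∧
        ‖R ((r : ℂ) * Complex.exp (Complex.I * (β : ℂ)))‖
          ≤ VariableOrder.resolventConst α₀ αM ρ₀ ρM r β * max (r ^ (-α₀)) (r ^ (-αM))) ∧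
      DifferentiableOn ℂ R Complex.slitPlane ∧
      ∃ K : ℝ, ∀ p ∈ Complex.slitPlane, ‖R p‖ ≤ K := by
  obtain ⟨c, hc0, hc⟩ := hell
  have ha' : ∀ i j, MemLp (fun x => (a i j x : ℂ)) ⊤ (volume.restrict Ω) := fun i j =>
    (ha i j).ofReal
  have hq' : MemLp (fun x => (q x : ℂ)) κ (volume.restrict Ω) := hq.ofReal
  obtain ⟨C, hC, hCq⟩ := exists_eLpNorm_mul_test_le hd hΩbdd hκ hq'
  obtain ⟨Q, hQ⟩ := exists_potential hq'.1 hC fun w hw =>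
    eLpNorm_mul_le_of_mem_sobolevH10 hq'.1 hC hCq hw
  obtain ⟨P, hP0, hP⟩ := exists_poincare (d := d) hd hΩbdd
  -- A nonempty open set has positive measure, so the almost everywhere bounds hold at some point;
  -- this yields `α₀ ≤ α_M` and `ρ₀ ≤ ρ_M`.
  have hne : (volume.restrict Ω) ≠ 0 := by
    rw [Ne, Measure.restrict_eq_zero]
    exact (hΩopen.measure_pos volume hΩconn.nonempty).ne'
  have hneBot : (ae (volume.restrict Ω)).NeBot := ae_neBot.mpr hne
  have hα_le : α₀ ≤ αM := by
    obtain ⟨x, hx⟩ := hα_bound.exists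
    exact hx.1.trans hx.2
  have hρ_le : ρ₀ ≤ ρM := by
    obtain ⟨x, hx⟩ := hρ_bound.exists
    exact hx.1.trans hx.2
  set S := gradOperator ha' + (embL2 Ω).adjoint ∘L Q
  have hSin : ∀ u, inner ℂ u (S u)
      = inner ℂ u (gradOperator ha' u) + inner ℂ (embL2 Ω u) (Q u) := fun u =>
    inner_add_comp_apply _ _ u u
  have hS : ∀ u, (inner ℂ u (S u)).im = 0 := fun u => by
    rw [hSin, Complex.add_im, (re_im_inner_gradOperator ha' hsymm hc u).2,
      (re_im_inner_potential hQ hq_nonneg u).2, add_zero]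
  have hScoer : ∀ u, c / P * ‖u‖ ^ 2 ≤ (inner ℂ u (S u)).re := fun u => by
    rw [hSin, Complex.add_re]
    have h1 := (re_im_inner_gradOperator ha' hsymm hc u).1
    have h2 := (re_im_inner_potential hQ hq_nonneg u).1
    have h3 : c / P * ‖u‖ ^ 2 ≤ c * ∑ i, ‖weakDeriv Ω i u‖ ^ 2 := by
      rw [div_mul_eq_mul_div, div_le_iff₀ hP0, mul_assoc, mul_comm _ P]
      exact mul_le_mul_of_nonneg_left (hP u) hc0.le
    linarith
  have hcP : 0 < c / P := div_pos hc0 hP0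
  have hmain := fun (z : ℂ) (hz : |z.im| < Real.pi) =>
    isUnit_and_norm_formResolvent_le (S := S) hα hρ hα₀ hα_le hαM hρ₀ hα_bound hρ_bound
      (norm_embL2_le (Ω := Ω)) hS hcP hScoer hz
  have hlog : ∀ p ∈ Complex.slitPlane, |(Complex.log p).im| < Real.pi := by
    intro p hp
    rw [Complex.log_im, abs_lt]
    exact ⟨Complex.neg_pi_lt_arg p,
      (Complex.arg_le_pi p).lt_of_ne (Complex.mem_slitPlane_iff_arg.mp hp).1⟩
  have hinv := fun (z : ℂ) (hz : |z.im| < Real.pi) =>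
    isBoundedInverse_formResolvent hΩopen ha' hQ (memLp_mul_exp hα hρ z) (hmain z hz).1
  have hdom := dirichletOperator_domain_le (a := a) hΩopen ha' hQ
  -- The domain of the sum is an intersection in which the domain of `A₀` is the smaller set. The
  -- resolvent is defined through `p^α = e^{α log p}`, which moves all dependence on `p` into `log
  -- p`.
  refine ⟨inf_eq_left.mpr hdom,
    fun p => formResolvent (embL2 Ω) S (mulL _ (expSymbol hα hρ (Complex.log p))),
    fun p hp => ?_, fun r hr β hβ1 hβ2 => ?_, fun p hp => ?_,
    1 / (Real.cos (Real.pi * αM / 2) * (c / P)), fun p hp => (hmain _ (hlog p hp)).2⟩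
  · have h := hinv _ (hlog p hp)
    refine ⟨?_, fun f => ?_⟩
    · have e : (fun x => (ρ x : ℂ) * p ^ (α x : ℂ))
          = fun x => (ρ x : ℂ) * Complex.exp (Complex.log p * α x) := by
        funext x
        rw [Complex.cpow_def_of_ne_zero (Complex.slitPlane_ne_zero hp)]
      rw [pencil, e]
      exact h
    · obtain ⟨hf, -⟩ := h.1 f
      exact hf.1.1
  -- For `|β| < π` the principal logarithm of `r e^{iβ}` is `log r + iβ`, so the polar symbol is
  -- again `ρ e^{zα}`.
  · have hz : Complex.log ((r : ℂ) * Complex.exp (Complex.I * β))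
        = (Real.log r : ℂ) + β * Complex.I := by
      rw [Complex.log_ofReal_mul hr (Complex.exp_ne_zero _), mul_comm Complex.I,
        Complex.log_exp (by simpa using hβ1) (by simpa using hβ2.le)]
    set z : ℂ := (Real.log r : ℂ) + β * Complex.I with hzdef
    have hzre : z.re = Real.log r := by simp [hzdef]
    have hzim : z.im = β := by simp [hzdef]
    have hzπ : |z.im| < Real.pi := by rw [hzim]; exact abs_lt.mpr ⟨hβ1, hβ2⟩
    simp only [hz]
    refine ⟨?_, ?_⟩
    · have e : (fun x => (ρ x : ℂ) * ((r ^ α x : ℝ) : ℂ)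
            * Complex.exp (Complex.I * (β : ℂ) * (α x : ℂ)))
          = fun x => (ρ x : ℂ) * Complex.exp (z * α x) := by
        funext x
        rw [mul_assoc, Real.rpow_def_of_pos hr, Complex.ofReal_exp, ← Complex.exp_add, hzdef]
        push_cast
        ring_nf
      rw [polarPencil, e]
      exact hinv z hzπ
    · have := norm_formResolvent_le_resolventConst (S := S) (J := embL2 Ω) hα hρ hα₀ hα_le hαM
        hρ₀ hρ_le hα_bound hρ_bound hS hcP hScoer hzπ (hmain z hzπ).1 hr hzre
      rwa [hzim] at this
  · have hα1 : ∀ᵐ x ∂(volume.restrict Ω), |α x| ≤ 1 := hα_bound.mono fun x hx =>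
      abs_le.mpr ⟨by linarith, by linarith⟩
    have hρ1 : ∀ᵐ x ∂(volume.restrict Ω), |ρ x| ≤ ρM := hρ_bound.mono fun x hx =>
      abs_le.mpr ⟨by linarith, hx.2⟩
    have hU := (hmain _ (hlog p hp)).1
    have h := differentiableAt_formResolvent_log hα hρ hα1 hρ1 hp hU
    exact h.differentiableWithinAt
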